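/- Let $\mathbb K$ be a field of characteristic zero. For $r\in\mathbb N$ let $\mathcal L_{r,2}=\mathbb K^r\oplus\bigwedge^2\mathbb K^r$ be the free $2$-step nilpotent Lie algebra of rank $r$ over $\mathbb K$; its bracket is given by $[X,Y]=X\wedge Y$ for $X,Y\in\mathbb K^r$, with $\bigwedge^2\mathbb K^r$ central. For a Lie algebra $\mathfrak g$ over $\mathbb K$ let $\mu(\mathfrak g)$ be the minimal dimension of a finite-dimensional $\mathbb K$-vector space $V$ that admits a faithful representation of $\mathfrak g$, i.e. an injective Lie algebra homomorphism $\mathfrak g\to\mathfrak{gl}(V)$. Then $$\mu(\mathcal L_{r,2})=\begin{cases}\left\lceil\sqrt{2r(r-1)}\,\right\rceil+2, & \text{if } r\ge 4,\\[1mm] 2r-1, & \text{if } r=2,3,4,5\end{cases}$$ (the two expressions agree for $r=4,5$). In particular, as $r\to\infty$, $\mu(\mathcal L_{r,2})\sim\sqrt2\,r$ and $\mu(\mathcal L_{r,2})\sim 2\sqrt{\dim\mathcal L_{r,2}}$, where $f(r)\sim g(r)$ means $f(r)/g(r)\to1$. -/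

import Mathlib

open Filter Asymptotics

/-- The underlying space `K^r ⊕ ⋀² K^r` of the free 2-step nilpotent Lie algebra of rank `r`. -/
def FreeTwoStepNilpotent (K : Type*) [Field K] (r : ℕ) : Type _ :=
  (Fin r → K) × ⋀[K]^2 (Fin r → K)

namespace FreeTwoStepNilpotent

noncomputable section

variable (K : Type*) [Field K] (r : ℕ)

instance : AddCommGroup (FreeTwoStepNilpotent K r) :=
  inferInstanceAs (AddCommGroup ((Fin r → K) × ⋀[K]^2 (Fin r → K)))

instance : Module K (FreeTwoStepNilpotent K r) :=
  inferInstanceAs (Module K ((Fin r → K) × ⋀[K]^2 (Fin r → K)))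

variable {K r}

/-- The element `x ∧ y` of `⋀² K^r`. -/
def wedge (x y : Fin r → K) : ⋀[K]^2 (Fin r → K) := exteriorPower.ιMulti K 2 ![x, y]

theorem wedge_self (x : Fin r → K) : wedge x x = 0 :=
  (exteriorPower.ιMulti K 2).map_eq_zero_of_eq ![x, x] (i := 0) (j := 1) rfl (by decide)

theorem update_fst {α : Type*} (x y z : α) : Function.update ![x, y] 0 z = ![z, y] := by
  funext i; fin_cases i <;> rfl

theorem update_snd {α : Type*} (x y z : α) : Function.update ![x, y] 1 z = ![x, z] := by
  funext i; fin_cases i <;> rfl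

theorem wedge_add_left (x x' y : Fin r → K) : wedge (x + x') y = wedge x y + wedge x' y := by
  have h := (exteriorPower.ιMulti K 2 (M := Fin r → K)).map_update_add ![x, y] 0 x x'
  rwa [update_fst, update_fst, update_fst] at h

theorem wedge_add_right (x y y' : Fin r → K) : wedge x (y + y') = wedge x y + wedge x y' := by
  have h := (exteriorPower.ιMulti K 2 (M := Fin r → K)).map_update_add ![x, y] 1 y y'
  rwa [update_snd, update_snd, update_snd] at h

theorem wedge_smul_right (t : K) (x y : Fin r → K) : wedge x (t • y) = t • wedge x y := by
  have h := (exteriorPower.ιMulti K 2 (M := Fin r → K)).map_update_smul ![x, y] 1 t y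
  rwa [update_snd, update_snd] at h

theorem wedge_zero_left (y : Fin r → K) : wedge 0 y = 0 := by
  have h := wedge_add_left 0 0 y
  simpa using h

theorem wedge_zero_right (x : Fin r → K) : wedge x 0 = 0 := by
  have h := wedge_add_right x 0 0
  simpa using h

/-- The Lie bracket: `⁅x + z, y + w⁆ = x ∧ y` for `x, y ∈ K^r` and `z, w ∈ ⋀² K^r`. -/
instance : Bracket (FreeTwoStepNilpotent K r) (FreeTwoStepNilpotent K r) where
  bracket u v := ((0 : Fin r → K), wedge u.1 v.1)

theorem bracket_def (u v : FreeTwoStepNilpotent K r) :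
    ⁅u, v⁆ = ((0 : Fin r → K), wedge u.1 v.1) := rfl

instance : LieRing (FreeTwoStepNilpotent K r) where
  add_lie u v w := by
    refine Prod.ext (add_zero (0 : Fin r → K)).symm ?_
    exact wedge_add_left u.1 v.1 w.1
  lie_add u v w := by
    refine Prod.ext (add_zero (0 : Fin r → K)).symm ?_
    exact wedge_add_right u.1 v.1 w.1
  lie_self u := Prod.ext rfl (wedge_self u.1)
  leibniz_lie u v w := by
    refine Prod.ext (add_zero (0 : Fin r → K)).symm ?_
    change wedge u.1 0 = wedge 0 w.1 + wedge v.1 0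
    rw [wedge_zero_left, wedge_zero_right, wedge_zero_right, add_zero]

instance : LieAlgebra K (FreeTwoStepNilpotent K r) where
  lie_smul t u v := by
    refine Prod.ext (smul_zero t).symm ?_
    exact wedge_smul_right t u.1 v.1

end

end FreeTwoStepNilpotent

section

universe u v

/- `Module.End K V` carries the commutator bracket, i.e. it is `gl(V)`. -/
attribute [local instance 100] LieRing.ofAssociativeRing

/-- `μ(g)`: the minimal dimension of a finite-dimensional vector space `V` over `K` that carries a
faithful representation, i.e. an injective Lie algebra homomorphism `π : g → gl(V)`.
(If there is no such representation, the value is `0`; conversely, a positive value is always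
attained.) The vector spaces may be taken in the universe of `K`, as each finite-dimensional
vector space is isomorphic to some `K^n`. -/
noncomputable def minFaithfulDim (K : Type u) [Field K] (g : Type v) [LieRing g] [LieAlgebra K g] :
    ℕ :=
  sInf {n : ℕ | ∃ (V : Type u) (_ : AddCommGroup V) (_ : Module K V) (_ : FiniteDimensional K V)
    (π : g →ₗ⁅K⁆ Module.End K V), Function.Injective π ∧ Module.finrank K V = n}

end

/-! Lower bound. The semisimple Jordan part of each basis operator commutes with the whole family,
because the commutators are central. Discarding these parts makes the basis operators nilpotent and
changes no commutator (`exists_nilpotent_family`). Let `Z` be the span of the commutators, of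
dimension `r.choose 2`, let `A` be the sum of the images of the operators, `U` a complement of `A`,
and `P ⊆ A` the sum of the images of elements of `Z`. A Nakayama lemma (`le_of_le_sup_iSup_map`)
shows that `U` generates `V`, so the central operators in `Z` are determined on `U` and `dim Z ≤ dim
U * dim P`. It also gives `P < A`. If `P` has codimension at least 2 in `A`, then `r.choose 2 ≤ a *
b` with `a + b + 2 ≤ dim V`, and AM-GM yields the square root. In codimension 1,
`two_mul_le_of_finrank_eq` shows that either such `a`, `b` still exist or `2 * r - 1 ≤ dim V`.

Upper bound. On `K^p ⊕ K^q ⊕ K^s` let `u` act by `K^s → K^q → K^p` through matrices `B k` and `A k`.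
The bivector with alternating matrix `M` then acts as `∑ k, A k * M * B k`, so faithfulness means
that this sum vanishes only for `M = 0`. With `q = 1` and coordinate projections the dimension is `2
* r - 1`. With `q = 2` and `p`, `s` as equal as possible, generic matrices work once `p + s ≥
√(2r(r-1))`. They are found by counting over a large prime field
(`exists_separatesAlternating_of_card`), stratified by the rank of `M`, and lifted to characteristic
zero through a nonvanishing determinant. -/

/-! ### Commutators commuting with their factors -/

section Commutators

/-- `[Nᵏ⁺¹, Y] = (k + 1) Nᵏ C` when `C = [N, Y]` commutes with `N`. -/
theorem pow_succ_mul_eq_of_commutator {R : Type*} [Ring R] {N Y C : R}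
    (hC : N * Y - Y * N = C) (hNC : Commute N C) (k : ℕ) :
    N ^ (k + 1) * Y = Y * N ^ (k + 1) + (k + 1 : ℕ) • (N ^ k * C) := by
  have hNY : N * Y = Y * N + C := by rw [← hC]; abel
  induction k with
  | zero => simp [hNY]
  | succ k ih =>
    have h1 : N ^ k * C * N = N ^ (k + 1) * C := by
      rw [mul_assoc, ← hNC.eq, ← mul_assoc, ← pow_succ]
    rw [pow_succ, mul_assoc, hNY, mul_add, ← mul_assoc, ih, add_mul, mul_assoc Y, ← pow_succ,
      smul_mul_assoc, h1, add_assoc, ← succ_nsmul]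

/-- Bracketing `N ^ (i + 1) * C ^ j = 0` with `Y` gives `(i + 1) • (N ^ i * C ^ (j + 1)) = 0`.
Characteristic zero removes the factor, so powers of `N` are traded one by one for powers of `C`. -/
theorem isNilpotent_commutator {K R : Type*} [Field K] [CharZero K] [Ring R] [Algebra K R]
    {N Y C : R} (hC : N * Y - Y * N = C) (hNC : Commute N C) (hYC : Commute Y C)
    (hN : IsNilpotent N) : IsNilpotent C := by
  obtain ⟨k, hk⟩ := hN
  have key : ∀ j ≤ k, N ^ (k - j) * C ^ j = 0 := by
    intro j hj
    induction j with
    | zero => simpa using hk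
    | succ j ih =>
      obtain ⟨i, hi⟩ : ∃ i, k - j = i + 1 := ⟨k - (j + 1), by omega⟩
      have h0 := ih (by omega)
      rw [hi] at h0
      have h1 := pow_succ_mul_eq_of_commutator hC hNC i
      have h2 : N ^ (i + 1) * Y * C ^ j = Y * (N ^ (i + 1) * C ^ j)
          + (i + 1 : ℕ) • (N ^ i * C ^ (j + 1)) := by
        rw [h1, add_mul, mul_assoc Y, smul_mul_assoc, mul_assoc (N ^ i), ← pow_succ']
      rw [mul_assoc, (hYC.pow_right j).eq, ← mul_assoc, h0, zero_mul, mul_zero, zero_add] at h2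
      have h3 : ((i + 1 : ℕ) : K) • (N ^ i * C ^ (j + 1)) = 0 := by
        rw [Nat.cast_smul_eq_nsmul]; exact h2.symm
      rw [show k - (j + 1) = i by omega]
      exact (smul_eq_zero.mp h3).resolve_left (Nat.cast_ne_zero.mpr (Nat.succ_ne_zero i))
  exact ⟨k, by simpa using key k le_rfl⟩

/-- The commutator with `Y` acts on polynomials in `S` as a derivation. -/
theorem aeval_mul_sub_mul_aeval {K R : Type*} [Field K] [Ring R] [Algebra K R]
    {S Y C : R} (hC : S * Y - Y * S = C) (hSC : Commute S C) (f : Polynomial K) :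
    Polynomial.aeval S f * Y - Y * Polynomial.aeval S f
      = Polynomial.aeval S (Polynomial.derivative f) * C := by
  induction f using Polynomial.induction_on' with
  | add f g hf hg =>
    simp only [map_add, add_mul, mul_add, ← hf, ← hg]; abel
  | monomial n a =>
    rw [Polynomial.derivative_monomial, Polynomial.aeval_monomial, Polynomial.aeval_monomial]
    rcases n with _ | n
    · simp [Algebra.commutes]
    · rw [mul_assoc, pow_succ_mul_eq_of_commutator hC hSC, mul_add, ← mul_assoc Y,
        ← Algebra.commutes a Y, mul_assoc, add_sub_cancel_left, Nat.add_sub_cancel,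
        mul_smul_comm, map_mul, map_natCast, mul_assoc, mul_assoc, ← mul_assoc _ _ (S ^ n * C),
        ← Nat.cast_comm, mul_assoc, nsmul_eq_mul]

/-- A separable element whose commutator with `Y` commutes with it commutes with `Y`. -/
theorem commute_of_separable {K R : Type*} [Field K] [Ring R] [Algebra K R]
    {S Y : R} (hSC : Commute S (S * Y - Y * S)) {f : Polynomial K}
    (hf : f.Separable) (hS : Polynomial.aeval S f = 0) : Commute S Y := by
  have h := aeval_mul_sub_mul_aeval rfl hSC f
  rw [hS, zero_mul, mul_zero, sub_zero] at h
  -- Separability makes `f'(S)` invertible, by Bézout, and `f'(S)` kills the commutator.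
  obtain ⟨a, b, hab⟩ := hf
  have h1 := congrArg (Polynomial.aeval S) hab
  rw [map_add, map_mul, map_mul, hS, mul_zero, zero_add, map_one] at h1
  have h2 : S * Y - Y * S = 0 := by
    rw [← one_mul (S * Y - Y * S), ← h1, mul_assoc, ← h, mul_zero]
  exact sub_eq_zero.mp h2

end Commutators

/-! ### Reduction to nilpotent operators, and Nakayama lemmas -/

section Nilpotent

variable {K : Type*} [Field K] {V : Type*} [AddCommGroup V] [Module K V]

/-- `[X u, X v]` for a linear family `X` of endomorphisms. -/
def famComm {E : Type*} [AddCommGroup E] [Module K E] (X : E →ₗ[K] Module.End K V) (u v : E) :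
    Module.End K V := X u * X v - X v * X u

section

variable {E : Type*} [AddCommGroup E] [Module K E] (X : E →ₗ[K] Module.End K V)

theorem famComm_add_left (u u' v : E) : famComm X (u + u') v = famComm X u v + famComm X u' v := by
  simp only [famComm, map_add, add_mul, mul_add]; abel

theorem famComm_smul_left (t : K) (u v : E) : famComm X (t • u) v = t • famComm X u v := by
  simp only [famComm, map_smul, smul_mul_assoc, mul_smul_comm, smul_sub]

theorem famComm_add_right (u v v' : E) : famComm X u (v + v') = famComm X u v + famComm X u v' := by
  simp only [famComm, map_add, add_mul, mul_add]; abel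

theorem famComm_smul_right (t : K) (u v : E) : famComm X u (t • v) = t • famComm X u v := by
  simp only [famComm, map_smul, smul_mul_assoc, mul_smul_comm, smul_sub]

end

/-- A family of endomorphisms with central commutators can be replaced by one that is nilpotent
on the standard basis and has the same commutators. -/
theorem exists_nilpotent_family [CharZero K] [FiniteDimensional K V] {r : ℕ}
    (X : (Fin r → K) →ₗ[K] Module.End K V)
    (hX : ∀ u v w, Commute (famComm X u v) (X w)) :
    ∃ X' : (Fin r → K) →ₗ[K] Module.End K V,
      (∀ i, IsNilpotent (X' (Pi.single i 1))) ∧ (∀ u v, famComm X' u v = famComm X u v) ∧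
      ∀ u v w, Commute (famComm X' u v) (X' w) := by
  have hJ := fun i : Fin r =>
    Module.End.exists_isNilpotent_isSemisimple (K := K) (f := X (Pi.single i 1))
  choose n hn s hs hnil hss hsum using hJ
  have hsX : ∀ i v, Commute (s i) (X v) := by
    intro i v
    -- For `T = f(X eᵢ)` the commutator is `f'(X eᵢ)` times a central commutator, so it commutes
    -- with `T`. The semisimple part is such a `T`, with separable minimal polynomial.
    have hc : ∀ T ∈ Algebra.adjoin K {X (Pi.single i 1)}, Commute T (T * X v - X v * T) := by
      intro T hT
      rw [Algebra.adjoin_singleton_eq_range_aeval] at hT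
      obtain ⟨f, rfl⟩ := hT
      have hcom := hX (Pi.single i 1) v (Pi.single i 1)
      have h := aeval_mul_sub_mul_aeval (K := K) (S := X (Pi.single i 1)) (Y := X v) rfl hcom.symm f
      simp only [AlgHom.toRingHom_eq_coe, RingHom.coe_coe] at h ⊢
      rw [h]
      refine Commute.mul_right ?_ ?_
      · rw [Commute, SemiconjBy, ← map_mul, ← map_mul, mul_comm]
      · exact (Algebra.commute_of_mem_adjoin_singleton_of_commute (R := K)
          (by rw [Algebra.adjoin_singleton_eq_range_aeval]; exact ⟨f, rfl⟩) hcom).symm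
    exact commute_of_separable (hc _ (hs i)) (f := minpoly K (s i))
      (PerfectField.separable_iff_squarefree.mpr (hss i).minpoly_squarefree) (minpoly.aeval K _)
  have hss' : ∀ i j, Commute (s i) (s j) := fun i j =>
    Algebra.commute_of_mem_adjoin_singleton_of_commute (R := K) (hs j) (hsX i _)
  have hnX : ∀ i, n i = X (Pi.single i 1) - s i := fun i => by rw [hsum i]; simp
  let X' : (Fin r → K) →ₗ[K] Module.End K V := Fintype.linearCombination K n
  let S : (Fin r → K) →ₗ[K] Module.End K V := Fintype.linearCombination K s
  have hSX : ∀ u v, Commute (S u) (X v) := fun u v => by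
    simp only [S, Fintype.linearCombination_apply]
    exact Commute.sum_left _ _ _ fun i _ => (hsX i v).smul_left _
  have hSS : ∀ u v, Commute (S u) (S v) := fun u v => by
    simp only [S, Fintype.linearCombination_apply]
    exact Commute.sum_left _ _ _ fun i _ => Commute.sum_right _ _ _ fun j _ =>
      ((hss' i j).smul_left _).smul_right _
  have hX' : ∀ u, X' u = X u - S u := by
    intro u
    refine LinearMap.congr_fun (f := X') (g := X - S) ?_ u
    refine (Pi.basisFun K (Fin r)).ext fun i => ?_
    simp [X', S, hnX, Fintype.linearCombination_apply, Pi.single_apply]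
  have hcomm : ∀ u v, famComm X' u v = famComm X u v := by
    intro u v
    have h1 := (hSX u v).eq
    have h2 := (hSX v u).eq
    have h3 := (hSS u v).eq
    simp only [famComm, hX', sub_mul, mul_sub, h1, h2, h3]
    abel
  refine ⟨X', fun i => ?_, hcomm, fun u v w => ?_⟩
  · have : X' (Pi.single i 1) = n i := by
      simp [X', Fintype.linearCombination_apply, Pi.single_apply]
    rw [this]; exact hnil i
  · rw [hcomm, hX']
    refine (hX u v w).sub_right ?_
    exact (((hSX w u).mul_right (hSX w v)).sub_right ((hSX w v).mul_right (hSX w u))).symm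

/-- A nilpotent operator cannot be needed to generate a module that it preserves. -/
theorem le_of_le_sup_map_nilpotent {T : Module.End K V} (hT : IsNilpotent T)
    {M W : Submodule K V} (hW : W ≤ W.comap T)
    (h : M ≤ W ⊔ M.map T) : M ≤ W := by
  have key : ∀ k, M ≤ W ⊔ M.map (T ^ k) := by
    intro k
    induction k with
    | zero => simp [Module.End.one_eq_id]
    | succ k ih =>
      have h1 : M.map T ≤ W ⊔ M.map (T ^ (k + 1)) := by
        calc M.map T ≤ (W ⊔ M.map (T ^ k)).map T := Submodule.map_mono ih
          _ = W.map T ⊔ M.map (T ^ (k + 1)) := by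
            rw [Submodule.map_sup, pow_succ', Module.End.mul_eq_comp, Submodule.map_comp]
          _ ≤ _ := sup_le_sup_right (Submodule.map_le_iff_le_comap.mpr hW) _
      exact h.trans (sup_le le_sup_left h1)
  obtain ⟨k, hk⟩ := hT
  simpa [hk] using key k

/-- Nakayama's lemma for commuting nilpotent operators. -/
theorem le_of_le_sup_iSup_map_commuting {ι : Type*} (s : Finset ι) {T : ι → Module.End K V}
    (hT : ∀ i, IsNilpotent (T i)) {M W : Submodule K V} (hW : ∀ i, W ≤ W.comap (T i))
    (hTT : ∀ i j, (M.map (T j)).map (T i) ≤ W ⊔ M.map (T j))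
    (h : M ≤ W ⊔ ⨆ i ∈ s, M.map (T i)) : M ≤ W := by
  classical
  induction s using Finset.induction_on with
  | empty => simpa using h
  | insert i s hi ih =>
    rw [Finset.iSup_insert, sup_comm (M.map (T i)), ← sup_assoc] at h
    -- The operator `T i` is removed by the one-operator case, applied with `W` enlarged by the
    -- images under the remaining operators; `hTT` makes that sum stable under `T i`.
    refine ih (le_of_le_sup_map_nilpotent (hT i) ?_ h)
    rw [← Submodule.map_le_iff_le_comap, Submodule.map_sup, Submodule.map_iSup]
    refine sup_le ((Submodule.map_le_iff_le_comap.mpr (hW i)).trans le_sup_left) (iSup_le fun j => ?_)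
    rw [Submodule.map_iSup]
    refine iSup_le fun hj => (hTT i j).trans (sup_le_sup_left ?_ _)
    exact le_iSup₂_of_le (f := fun j (_ : j ∈ s) => M.map (T j)) j hj le_rfl

/-- Nakayama's lemma for a family of nilpotent operators with central commutators. -/
theorem le_of_le_sup_iSup_map [CharZero K] {r : ℕ} {X : (Fin r → K) →ₗ[K] Module.End K V}
    (hnil : ∀ i, IsNilpotent (X (Pi.single i 1)))
    (hX : ∀ u v w, Commute (famComm X u v) (X w)) {M W : Submodule K V}
    (hM : ∀ u, M ≤ M.comap (X u)) (hW : ∀ u, W ≤ W.comap (X u))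
    (h : M ≤ W ⊔ ⨆ i, M.map (X (Pi.single i 1))) : M ≤ W := by
  let C : Fin r × Fin r → Module.End K V := fun p => famComm X (Pi.single p.1 1) (Pi.single p.2 1)
  have hinv : ∀ {Q : Submodule K V}, (∀ u, Q ≤ Q.comap (X u)) → ∀ p, Q ≤ Q.comap (C p) := by
    intro Q hQ p x hx
    exact Q.sub_mem (hQ _ (hQ _ hx)) (hQ _ (hQ _ hx))
  have hCX : ∀ p w, Commute (C p) (X w) := fun p w => hX _ _ w
  have hCC : ∀ p q, Commute (C p) (C q) := fun p q =>
    ((hCX p _).mul_right (hCX p _)).sub_right ((hCX p _).mul_right (hCX p _))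
  have hmapC : ∀ {T : Module.End K V}, (M ≤ M.comap T) → ∀ p, Commute (C p) T →
      (M.map (C p)).map T ≤ M.map (C p) := by
    rintro T hMT p hp _ ⟨_, ⟨x, hx, rfl⟩, rfl⟩
    exact ⟨T x, hMT hx, LinearMap.congr_fun hp.eq x⟩
  -- The commuting case is used twice: for the commutators `C p`, and then for the `X eᵢ` modulo `∑
  -- C p M`, where they commute on `M`.
  refine le_of_le_sup_iSup_map_commuting Finset.univ (T := C) ?_ (hinv hW)
    (fun p q => (hmapC (hinv hM p) q (hCC q p)).trans le_sup_right) ?_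
  · exact fun p => isNilpotent_commutator (K := K) rfl (hCX p _).symm (hCX p _).symm (hnil _)
  refine le_of_le_sup_iSup_map_commuting Finset.univ (T := fun i => X (Pi.single i 1)) hnil
    (fun i => ?_) (fun i j => ?_) ?_
  · rw [← Submodule.map_le_iff_le_comap, Submodule.map_sup, Submodule.map_iSup]
    refine sup_le ((Submodule.map_le_iff_le_comap.mpr (hW _)).trans le_sup_left) (iSup_le fun p => ?_)
    rw [Submodule.map_iSup]
    refine iSup_le fun hp => (hmapC (hM _) p (hCX p _)).trans (le_sup_of_le_right ?_)
    exact le_iSup₂_of_le (f := fun p (_ : p ∈ Finset.univ) => M.map (C p)) p hp le_rfl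
  · rintro _ ⟨_, ⟨x, hx, rfl⟩, rfl⟩
    have h1 : X (Pi.single i 1) (X (Pi.single j 1) x)
        = C (i, j) x + X (Pi.single j 1) (X (Pi.single i 1) x) := by
      simp [C, famComm]
    rw [h1]
    refine Submodule.add_mem _ (Submodule.mem_sup_left (Submodule.mem_sup_right ?_)) (Submodule.mem_sup_right ⟨_, hM _ hx, rfl⟩)
    exact Submodule.mem_iSup_of_mem (i, j) (Submodule.mem_iSup_of_mem (Finset.mem_univ _) ⟨x, hx, rfl⟩)
  · refine h.trans (sup_le (le_sup_left.trans le_sup_left) (le_sup_of_le_right ?_))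
    simp

end Nilpotent

/-! ### Dimension estimate for nilpotent families -/

section LowerBound

variable {K : Type*} [Field K] {V : Type*} [AddCommGroup V] [Module K V]

/-- A linear map whose rank is at most the dimension of the source minus two kills two linearly
independent vectors. -/
theorem exists_linearIndependent_pair_ker {E F : Type*} [AddCommGroup E] [Module K E]
    [FiniteDimensional K E] [AddCommGroup F] [Module K F] (f : E →ₗ[K] F)
    (h : Module.finrank K f.range + 2 ≤ Module.finrank K E) :
    ∃ u v : E, LinearIndependent K ![u, v] ∧ f u = 0 ∧ f v = 0 := by
  have h1 := f.finrank_range_add_finrank_ker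
  obtain ⟨g, hg⟩ := exists_linearIndependent_of_le_finrank (R := K) (M := f.ker) (n := 2) (by omega)
  refine ⟨g 0, g 1, ?_, (g 0).2, (g 1).2⟩
  have h2 := hg.map' f.ker.subtype (Submodule.ker_subtype _)
  have h3 : ![(g 0 : E), (g 1 : E)] = f.ker.subtype ∘ g := by
    funext i; fin_cases i <;> rfl
  rw [h3]; exact h2

/-- If the operators in `Z` map `U` to `P` and `Z` is large, then a nonzero operator in `Z` maps `U`
to the given subspace `Q` of `P`. -/
theorem exists_ne_zero_map_le [FiniteDimensional K V] {Z : Submodule K (Module.End K V)}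
    {U P : Submodule K V} (hP : ∀ z ∈ Z, ∀ v, z v ∈ P) (Q : Submodule K P)
    (h : Module.finrank K U * Module.finrank K (P ⧸ Q) < Module.finrank K Z) :
    ∃ z ∈ Z, z ≠ 0 ∧ ∀ v ∈ U, ∃ w ∈ Q, z v = w := by
  let Φ : Z →ₗ[K] U →ₗ[K] P ⧸ Q :=
    { toFun := fun z => Q.mkQ ∘ₗ
        LinearMap.codRestrict P ((z : Module.End K V) ∘ₗ U.subtype) fun v => hP z z.2 v
      map_add' := fun z z' => by
        ext v
        exact Q.mkQ.map_add ⟨(z : Module.End K V) v, _⟩ ⟨(z' : Module.End K V) v, _⟩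
      map_smul' := fun t z => by
        ext v
        exact Q.mkQ.map_smul t ⟨(z : Module.End K V) v, hP z z.2 v⟩ }
  have hni : ¬ Function.Injective Φ := fun hinj => by
    have := LinearMap.finrank_le_finrank_of_injective hinj
    rw [Module.finrank_linearMap] at this
    omega
  rw [← LinearMap.ker_eq_bot, Submodule.eq_bot_iff] at hni
  push Not at hni
  obtain ⟨z, hz, hz0⟩ := hni
  refine ⟨z, z.2, fun h0 => hz0 (Subtype.ext h0), fun v hv => ⟨⟨z.1 v, hP z z.2 v⟩, ?_, rfl⟩⟩
  have := LinearMap.congr_fun (LinearMap.mem_ker.mp hz) ⟨v, hv⟩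
  exact (Submodule.Quotient.mk_eq_zero Q).mp this

variable {r : ℕ}

/-- A nilpotent family of operators on `V` with central, sufficiently independent commutators. -/
structure NilFamily (X : (Fin r → K) →ₗ[K] Module.End K V) : Prop where
  nil : ∀ i, IsNilpotent (X (Pi.single i 1))
  central : ∀ u v w, Commute (famComm X u v) (X w)
  indep : ∀ u v, LinearIndependent K ![u, v] → famComm X u v ≠ 0

/-- The span of the commutators. -/
def commSpan (X : (Fin r → K) →ₗ[K] Module.End K V) : Submodule K (Module.End K V) :=
  Submodule.span K (Set.range fun p : (Fin r → K) × (Fin r → K) => famComm X p.1 p.2)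

/-- The sum of the ranges of the operators. -/
def imageSum (X : (Fin r → K) →ₗ[K] Module.End K V) : Submodule K V := ⨆ u, (X u).range

/-- The sum of the ranges of the commutators. -/
def commImage (X : (Fin r → K) →ₗ[K] Module.End K V) : Submodule K V :=
  ⨆ z : commSpan X, (z : Module.End K V).range

variable {X : (Fin r → K) →ₗ[K] Module.End K V}

theorem famComm_mem_commSpan (u v : Fin r → K) : famComm X u v ∈ commSpan X :=
  Submodule.subset_span ⟨(u, v), rfl⟩

theorem apply_mem_imageSum (u : Fin r → K) (v : V) : X u v ∈ imageSum X :=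
  Submodule.mem_iSup_of_mem u ⟨v, rfl⟩

theorem apply_mem_commImage {z : Module.End K V} (hz : z ∈ commSpan X) (v : V) :
    z v ∈ commImage X :=
  Submodule.mem_iSup_of_mem (⟨z, hz⟩ : commSpan X) ⟨v, rfl⟩

/-- The sum of the images of a submodule under a linear family is generated by the images under
the values on the standard basis. -/
theorem map_le_iSup_map_single (M : Submodule K V) (u : Fin r → K) :
    M.map (X u) ≤ ⨆ i, M.map (X (Pi.single i 1)) := by
  rintro _ ⟨x, hx, rfl⟩
  have hu : X u = ∑ i, u i • X (Pi.single i 1) := by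
    conv_lhs => rw [pi_eq_sum_univ' u, map_sum]
    refine Finset.sum_congr rfl fun i _ => ?_
    rw [map_smul]
  rw [hu, LinearMap.sum_apply]
  exact Submodule.sum_mem _ fun i _ => Submodule.smul_mem _ _
    (Submodule.mem_iSup_of_mem i ⟨x, hx, rfl⟩)

namespace NilFamily

theorem commute (hX : NilFamily X) {z : Module.End K V} (hz : z ∈ commSpan X) (u : Fin r → K) : Commute z (X u) := by
  induction hz using Submodule.span_induction with
  | mem x h => obtain ⟨p, rfl⟩ := h; exact hX.central _ _ _
  | zero => exact Commute.zero_left _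
  | add x y _ _ h1 h2 => exact h1.add_left h2
  | smul t x _ h => exact h.smul_left t

theorem apply_comm (hX : NilFamily X) {z : Module.End K V} (hz : z ∈ commSpan X) (u : Fin r → K) (v : V) :
    z (X u v) = X u (z v) := LinearMap.congr_fun (hX.commute hz u).eq v

theorem commute_commSpan (hX : NilFamily X) {z z' : Module.End K V} (hz : z ∈ commSpan X) (hz' : z' ∈ commSpan X) :
    Commute z z' := by
  induction hz' using Submodule.span_induction with
  | mem x h =>
    obtain ⟨p, rfl⟩ := h
    exact ((hX.commute hz _).mul_right (hX.commute hz _)).sub_right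
      ((hX.commute hz _).mul_right (hX.commute hz _))
  | zero => exact Commute.zero_right _
  | add x y _ _ h1 h2 => exact h1.add_right h2
  | smul t x _ h => exact h.smul_right t

theorem commImage_le : commImage X ≤ ⨆ i, (imageSum X).map (X (Pi.single i 1)) := by
  refine iSup_le fun z => ?_
  obtain ⟨z, hz⟩ := z
  rintro _ ⟨v, rfl⟩
  change z v ∈ _
  induction hz using Submodule.span_induction with
  | mem x h =>
    obtain ⟨p, rfl⟩ := h
    exact Submodule.sub_mem _
      (map_le_iSup_map_single _ _ ⟨_, apply_mem_imageSum _ _, rfl⟩)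
      (map_le_iSup_map_single _ _ ⟨_, apply_mem_imageSum _ _, rfl⟩)
  | zero => exact Submodule.zero_mem _
  | add x y _ _ h1 h2 => exact Submodule.add_mem _ h1 h2
  | smul t x _ h => exact Submodule.smul_mem _ _ h

theorem iSup_map_imageSum_le : ⨆ i, (imageSum X).map (X (Pi.single i 1)) ≤ imageSum X := by
  refine iSup_le fun i => ?_
  rintro _ ⟨v, _, rfl⟩
  exact apply_mem_imageSum _ _

/-- A central element that kills a complement of the image vanishes. -/
theorem eq_zero_of_forall_mem [CharZero K] (hX : NilFamily X) {U : Submodule K V} (hU : U ⊔ imageSum X = ⊤)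
    {z : Module.End K V} (hz : z ∈ commSpan X) (h : ∀ v ∈ U, z v = 0) : z = 0 := by
  have h1 : (⊤ : Submodule K V) ≤ z.ker := by
    -- Nakayama with `M = ⊤` and `W = ker z`, which is stable because `z` is central.
    refine le_of_le_sup_iSup_map hX.nil hX.central (fun u => by simp) (fun u v hv => ?_) ?_
    · rw [Submodule.mem_comap, LinearMap.mem_ker, hX.apply_comm hz, LinearMap.mem_ker.mp hv,
        map_zero]
    · rw [← hU]
      refine sup_le_sup h (iSup_le fun u => ?_)
      rw [← Submodule.map_top, hU]
      exact map_le_iSup_map_single _ _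
  exact LinearMap.ext fun v => h1 (Submodule.mem_top (x := v))

/-- The image sum is strictly larger than the commutator image. -/
theorem commImage_lt [CharZero K] (hX : NilFamily X) (hne : ∃ u v, famComm X u v ≠ 0) :
    commImage X < imageSum X := by
  refine lt_of_le_of_ne (commImage_le.trans iSup_map_imageSum_le) fun h => ?_
  -- Equality would make the image sum equal to its own image under the family, hence zero by
  -- Nakayama.
  have h1 : imageSum X ≤ ⊥ := by
    refine le_of_le_sup_iSup_map hX.nil hX.central (fun u x _ => apply_mem_imageSum _ _)
      (fun u => by simp) ?_
    exact (h.symm.le.trans commImage_le).trans le_sup_right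
  obtain ⟨u, v, huv⟩ := hne
  have h0 : ∀ w, X w = 0 := fun w => LinearMap.ext fun x => by
    simpa using h1 (apply_mem_imageSum (X := X) w x)
  exact huv (by simp [famComm, h0])

theorem exists_famComm_ne_zero (hX : NilFamily X) (hr : 2 ≤ r) : ∃ u v, famComm X u v ≠ 0 := by
  -- The zero functional serves only to produce two independent vectors.
  obtain ⟨u, v, huv, -, -⟩ := exists_linearIndependent_pair_ker (0 : (Fin r → K) →ₗ[K] K)
    (by rw [LinearMap.range_zero, finrank_bot]; simpa using hr)
  exact ⟨u, v, hX.indep u v huv⟩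

/-- The dimension estimate when the image sum is one dimension larger than the commutator image. -/
theorem two_mul_le_of_finrank_eq [CharZero K] [FiniteDimensional K V] (hX : NilFamily X)
    (hr : 2 ≤ r) {U : Submodule K V} (hU : IsCompl U (imageSum X))
    (hA : Module.finrank K (imageSum X) = Module.finrank K (commImage X) + 1)
    (hfail : ∀ a b, a + b + 2 ≤ Module.finrank K V → a * b < Module.finrank K (commSpan X)) :
    2 * r ≤ Module.finrank K V + 1 := by
  have hn := Submodule.finrank_add_eq_of_isCompl hU
  have hrE : Module.finrank K (Fin r → K) = r := by simp
  have hPA : commImage X ≤ imageSum X := commImage_le.trans iSup_map_imageSum_le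
  have hne := hX.exists_famComm_ne_zero hr
  have hlt := hX.commImage_lt hne
  -- the second image coincides with the commutator image
  have hA2 : ⨆ i, (imageSum X).map (X (Pi.single i 1)) = commImage X := by
    symm
    refine Submodule.eq_of_le_of_finrank_le commImage_le ?_
    have h1 : ⨆ i, (imageSum X).map (X (Pi.single i 1)) < imageSum X := by
      refine lt_of_le_of_ne iSup_map_imageSum_le fun h => ?_
      have h2 : imageSum X ≤ ⊥ :=
        le_of_le_sup_iSup_map hX.nil hX.central (fun u x _ => apply_mem_imageSum _ _)
          (fun u => by simp) (h.symm.le.trans le_sup_right)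
      rw [le_bot_iff] at h2
      rw [h2] at hlt
      exact not_lt_bot hlt
    have := Submodule.finrank_lt_finrank_of_lt h1
    omega
  have hXA : ∀ u, ∀ a ∈ imageSum X, X u a ∈ commImage X := fun u a ha =>
    hA2 ▸ map_le_iSup_map_single _ u ⟨a, ha, rfl⟩
  obtain ⟨x, hxA, hxP⟩ := SetLike.exists_of_lt hlt
  -- `θ` detects the one missing dimension: on the image sum its kernel is exactly the commutator
  -- image.
  obtain ⟨θ, hθx, hθP⟩ := Submodule.exists_le_ker_of_notMem hxP
  have hAx : imageSum X ≤ commImage X ⊔ Submodule.span K {x} := by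
    refine (Submodule.eq_of_le_of_finrank_le (sup_le hPA ?_) ?_).ge
    · rwa [Submodule.span_singleton_le_iff_mem]
    · rw [hA]
      refine Nat.succ_le_of_lt (Submodule.finrank_lt_finrank_of_lt ?_)
      refine lt_of_le_of_ne le_sup_left fun h => hxP ?_
      rw [h]
      exact Submodule.mem_sup_right (Submodule.mem_span_singleton_self x)
  have hθA : ∀ a ∈ imageSum X, θ a = 0 → a ∈ commImage X := by
    intro a ha h0
    obtain ⟨p, hp, w, hw, rfl⟩ := Submodule.mem_sup.mp (hAx ha)
    obtain ⟨t, rfl⟩ := Submodule.mem_span_singleton.mp hw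
    rw [map_add, LinearMap.mem_ker.mp (hθP hp), zero_add, map_smul, smul_eq_mul,
      mul_eq_zero, or_iff_left hθx] at h0
    simpa [h0] using hp
  have hUtop : U ⊔ imageSum X = ⊤ := hU.sup_eq_top
  have hsplit : ∀ v, ∃ y ∈ U, ∃ a ∈ imageSum X, v = y + a := fun v => by
    obtain ⟨y, hy, a, ha, h⟩ := Submodule.mem_sup.mp (hUtop ▸ Submodule.mem_top (x := v))
    exact ⟨y, hy, a, ha, h.symm⟩
  -- if `θ (X u v) ≠ 0` then `X u v` generates the image sum
  have hgen : ∀ u v, θ (X u v) ≠ 0 → ∀ z ∈ commSpan X, z v = 0 → ∀ a ∈ imageSum X, z a = 0 := by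
    intro u v huv z hz hzv
    have h1 : imageSum X ≤ z.ker := by
      refine le_of_le_sup_iSup_map hX.nil hX.central (fun u x _ => apply_mem_imageSum _ _)
        (fun w y hy => ?_) (fun a ha => ?_)
      · rw [Submodule.mem_comap, LinearMap.mem_ker, hX.apply_comm hz, LinearMap.mem_ker.mp hy,
          map_zero]
      · rw [hA2]
        have h2 : a - (θ a / θ (X u v)) • X u v ∈ commImage X := by
          refine hθA _ (Submodule.sub_mem _ ha (Submodule.smul_mem _ _ (apply_mem_imageSum _ _))) ?_
          rw [map_sub, map_smul, smul_eq_mul, div_mul_cancel₀ _ huv, sub_self]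
        rw [← add_sub_cancel ((θ a / θ (X u v)) • X u v) a]
        refine Submodule.add_mem _ (Submodule.mem_sup_left (Submodule.smul_mem _ _ ?_))
          (Submodule.mem_sup_right h2)
        rw [LinearMap.mem_ker, hX.apply_comm hz, hzv, map_zero]
    exact h1
  have hPpos : 0 < Module.finrank K (commImage X) := by
    rw [Nat.pos_iff_ne_zero]
    intro h0
    rw [Submodule.finrank_eq_zero] at h0
    obtain ⟨u, v, huv⟩ := hne
    refine huv (LinearMap.ext fun w => ?_)
    simpa [h0] using apply_mem_commImage (famComm_mem_commSpan (X := X) u v) w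
  have hUpos : 0 < Module.finrank K U := by
    rw [Nat.pos_iff_ne_zero]
    intro h0
    rw [Submodule.finrank_eq_zero] at h0
    obtain ⟨u, v, huv⟩ := hne
    exact huv (hX.eq_zero_of_forall_mem hUtop (famComm_mem_commSpan u v) (by simp [h0]))
  -- every line in the commutator image is the image of `U` under some central element
  have hline : ∀ y ∈ commImage X, y ≠ 0 →
      ∃ z ∈ commSpan X, z ≠ 0 ∧ ∀ v ∈ U, ∃ c : K, z v = c • y := by
    intro y hy hy0
    have hy0' : (⟨y, hy⟩ : commImage X) ≠ 0 := fun h => hy0 (congrArg Subtype.val h)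
    have h1 := (Submodule.span K {(⟨y, hy⟩ : commImage X)}).finrank_quotient_add_finrank
    rw [finrank_span_singleton hy0'] at h1
    obtain ⟨z, hz, hz0, h⟩ := exists_ne_zero_map_le (U := U)
      (fun z hz v => apply_mem_commImage hz v) (Submodule.span K {(⟨y, hy⟩ : commImage X)})
      -- The pair is `a = dim U`, `b = dim P - 1`, for which `a + b + 2` is exactly `dim V`.
      (hfail _ _ (by omega))
    refine ⟨z, hz, hz0, fun v hv => ?_⟩
    obtain ⟨w, hw, hzw⟩ := h v hv
    obtain ⟨c, rfl⟩ := Submodule.mem_span_singleton.mp hw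
    exact ⟨c, hzw⟩
  -- two independent operators mapping everything to the commutator image
  have hpair : ∀ u₁ u₂ : Fin r → K, (∀ v ∈ U, θ (X u₁ v) = 0) → (∀ v ∈ U, θ (X u₂ v) = 0) →
      ∀ v, X u₁ v ∈ commImage X ∧ X u₂ v ∈ commImage X := by
    intro u₁ u₂ h₁ h₂ v
    obtain ⟨y, hy, a, ha, rfl⟩ := hsplit v
    rw [map_add, map_add]
    exact ⟨Submodule.add_mem _ (hθA _ (apply_mem_imageSum _ _) (h₁ y hy)) (hXA _ _ ha),
      Submodule.add_mem _ (hθA _ (apply_mem_imageSum _ _) (h₂ y hy)) (hXA _ _ ha)⟩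
  let F : (Fin r → K) →ₗ[K] Module.Dual K U :=
    { toFun := fun u => θ ∘ₗ X u ∘ₗ U.subtype
      map_add' := fun u v => by ext; simp
      map_smul' := fun t u => by ext; simp }
  by_cases hP0 : ∀ y ∈ commImage X, ∀ u, X u y = 0
  -- When the family kills `P`, two operators with image in `P`, or two operators killing `A`,
  -- commute. This bounds `r` by `dim U + 1` and by `dim P + 1`, and the two bounds add up to the
  -- claim.
  · have hk : r ≤ Module.finrank K U + 1 := by
      by_contra! hlt'
      have hrk : Module.finrank K F.range ≤ Module.finrank K U := by
        rw [← Subspace.dual_finrank_eq (K := K) (V := U)]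
        exact Submodule.finrank_le _
      obtain ⟨u₁, u₂, hind, h₁, h₂⟩ := exists_linearIndependent_pair_ker F (by omega)
      refine hX.indep _ _ hind (LinearMap.ext fun v => ?_)
      obtain ⟨g₁, g₂⟩ := hpair u₁ u₂ (fun v hv => LinearMap.congr_fun h₁ ⟨v, hv⟩)
        (fun v hv => LinearMap.congr_fun h₂ ⟨v, hv⟩) v
      simp [famComm, hP0 _ g₁, hP0 _ g₂]
    have hp : r ≤ Module.finrank K (commImage X) + 1 := by
      by_contra! hlt'
      let G : (Fin r → K) →ₗ[K] commImage X :=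
        { toFun := fun u => ⟨X u x, hXA u x hxA⟩
          map_add' := fun u v => by ext; simp
          map_smul' := fun t u => by ext; simp }
      obtain ⟨u₁, u₂, hind, h₁, h₂⟩ := exists_linearIndependent_pair_ker G (by
        have := Submodule.finrank_le G.range
        omega)
      have hkill : ∀ u, G u = 0 → ∀ a ∈ imageSum X, X u a = 0 := by
        intro u hu a ha
        obtain ⟨p, hp, w, hw, rfl⟩ := Submodule.mem_sup.mp (hAx ha)
        obtain ⟨t, rfl⟩ := Submodule.mem_span_singleton.mp hw
        have : X u x = 0 := congrArg Subtype.val hu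
        rw [map_add, hP0 p hp, map_smul, this, smul_zero, add_zero]
      refine hX.indep _ _ hind (LinearMap.ext fun v => ?_)
      simp [famComm, hkill u₁ h₁ _ (apply_mem_imageSum _ _),
        hkill u₂ h₂ _ (apply_mem_imageSum _ _)]
    omega
  · push Not at hP0
    obtain ⟨y₀, hy₀, u₀, hu₀⟩ := hP0
    rcases Nat.lt_or_ge r 3 with hr3 | hr3
    · omega
    exfalso
    -- If `z v = 0` but `X u v ∉ P`, then `X u v` generates `A`, so `z` kills `A`. Since `X w` moves
    -- `y`, this forces all coefficients of `z` along `y` to vanish.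
    have hmove : ∀ y ∈ commImage X, (∃ u, X u y ≠ 0) → ∃ z ∈ commSpan X, z ≠ 0 ∧
        (∀ v ∈ U, ∃ c : K, z v = c • y) ∧ ∀ v ∈ U, z v = 0 → ∀ u, θ (X u v) = 0 := by
      rintro y hy ⟨w, hw⟩
      obtain ⟨z, hz, hz0, hzU⟩ := hline y hy fun h => hw (by simp [h])
      refine ⟨z, hz, hz0, hzU, fun v hv hzv u => ?_⟩
      by_contra hθ
      have hzA := hgen u v hθ z hz hzv
      refine hz0 (hX.eq_zero_of_forall_mem hUtop hz fun v' hv' => ?_)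
      obtain ⟨c, hc⟩ := hzU v' hv'
      have h1 := hzA _ (apply_mem_imageSum (X := X) w v')
      rw [hX.apply_comm hz, hc, map_smul, smul_eq_zero, or_iff_left hw] at h1
      rw [hc, h1, zero_smul]
    have hreach : ∀ v ∈ U, (∃ u, θ (X u v) ≠ 0) → ∀ y ∈ commImage X,
        ∃ z ∈ commSpan X, z v = y := by
      rintro v hv ⟨u, hu⟩
      have h1 : ∀ y ∈ commImage X, (∃ w, X w y ≠ 0) → ∃ z ∈ commSpan X, z v = y := by
        intro y hy hw
        obtain ⟨z, hz, -, hzU, h⟩ := hmove y hy hw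
        obtain ⟨c, hc⟩ := hzU v hv
        have hc0 : c ≠ 0 := fun h0 => hu (h v hv (by rw [hc, h0, zero_smul]) u)
        refine ⟨c⁻¹ • z, Submodule.smul_mem _ _ hz, ?_⟩
        rw [LinearMap.smul_apply, hc, inv_smul_smul₀ hc0]
      intro y hy
      by_cases hw : X u₀ y = 0
      -- A vector `y` killed by `X u₀` is the difference of `y + y₀` and `y₀`, neither of which is
      -- killed.
      · obtain ⟨z₁, hz₁, e₁⟩ := h1 (y + y₀) (Submodule.add_mem _ hy hy₀)
          ⟨u₀, by rwa [map_add, hw, zero_add]⟩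
        obtain ⟨z₂, hz₂, e₂⟩ := h1 y₀ hy₀ ⟨u₀, hu₀⟩
        exact ⟨z₁ - z₂, Submodule.sub_mem _ hz₁ hz₂, by rw [LinearMap.sub_apply, e₁, e₂]; simp⟩
      · exact h1 y hy ⟨u₀, hw⟩
    obtain ⟨z₀, hz₀, hz₀0, hz₀U, hz₀θ⟩ := hmove y₀ hy₀ ⟨u₀, hu₀⟩
    obtain ⟨v₀, hv₀, hzv₀⟩ : ∃ v₀ ∈ U, z₀ v₀ ≠ 0 := by
      by_contra! h
      exact hz₀0 (hX.eq_zero_of_forall_mem hUtop hz₀ h)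
    obtain ⟨u₁, u₂, hind, h₁, h₂⟩ := exists_linearIndependent_pair_ker
      (Module.Dual.eval K U ⟨v₀, hv₀⟩ ∘ₗ F) (by
        have := Submodule.finrank_le (Module.Dual.eval K U ⟨v₀, hv₀⟩ ∘ₗ F).range
        rw [Module.finrank_self] at this
        omega)
    -- `z₀` has rank one on `U` and all functionals `θ ∘ X u` vanish on its kernel there, so each is
    -- determined by its value at `v₀`. As `r ≥ 3`, two independent operators have image in `P`.
    have hker : ∀ u, θ (X u v₀) = 0 → ∀ v ∈ U, θ (X u v) = 0 := by
      intro u hu v hv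
      obtain ⟨c, hc⟩ := hz₀U v hv
      obtain ⟨c₀, hc₀⟩ := hz₀U v₀ hv₀
      have hc₀0 : c₀ ≠ 0 := fun h0 => hzv₀ (by rw [hc₀, h0, zero_smul])
      have h3 := hz₀θ (v - (c / c₀) • v₀) (Submodule.sub_mem _ hv (Submodule.smul_mem _ _ hv₀))
        (by rw [map_sub, map_smul, hc, hc₀, smul_smul, div_mul_cancel₀ _ hc₀0, sub_self]) u
      rwa [map_sub, map_smul, map_sub, map_smul, hu, smul_zero, sub_zero] at h3
    have hall := hpair u₁ u₂ (hker u₁ h₁) (hker u₂ h₂)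
    -- At such a `v` both operators agree with elements of the commutative space `commSpan X`.
    have hzero : ∀ v ∈ U, (∃ u, θ (X u v) ≠ 0) → famComm X u₁ u₂ v = 0 := by
      intro v hv hu
      obtain ⟨z₁, hz₁, e₁⟩ := hreach v hv hu _ (hall v).1
      obtain ⟨z₂, hz₂, e₂⟩ := hreach v hv hu _ (hall v).2
      have h4 := LinearMap.congr_fun (hX.commute_commSpan hz₁ hz₂).eq v
      simp only [Module.End.mul_apply] at h4
      simp only [famComm, LinearMap.sub_apply, Module.End.mul_apply]
      have a₁ : X u₁ (X u₂ v) = z₂ (z₁ v) := by rw [← e₂, ← hX.apply_comm hz₂, ← e₁]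
      have a₂ : X u₂ (X u₁ v) = z₁ (z₂ v) := by rw [← e₁, ← hX.apply_comm hz₁, ← e₂]
      rw [a₁, a₂, h4, sub_self]
    obtain ⟨v₁, hv₁, w₁, hw₁⟩ : ∃ v ∈ U, ∃ u, θ (X u v) ≠ 0 := by
      by_contra! h
      refine hlt.not_ge (iSup_le fun u => ?_)
      rintro _ ⟨v, rfl⟩
      exact (hpair u u (fun v hv => h v hv u) (fun v hv => h v hv u) v).1
    refine hX.indep _ _ hind (hX.eq_zero_of_forall_mem hUtop (famComm_mem_commSpan _ _) ?_)
    intro v hv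
    by_cases hu : ∃ u, θ (X u v) ≠ 0
    · exact hzero v hv hu
    · push Not at hu
      -- The vectors covered by `hzero` form the complement of a proper subspace of `U`, so they
      -- span `U`.
      have h5 := hzero (v + v₁) (Submodule.add_mem _ hv hv₁)
        ⟨w₁, by rwa [map_add, map_add, hu, zero_add]⟩
      rwa [map_add, hzero v₁ hv₁ ⟨w₁, hw₁⟩, add_zero] at h5

/-- The dimension estimate for nilpotent families. -/
theorem finrank_estimate [CharZero K] [FiniteDimensional K V] (hX : NilFamily X) (hr : 2 ≤ r) :
    (∃ a b, a + b + 2 ≤ Module.finrank K V ∧ Module.finrank K (commSpan X) ≤ a * b) ∨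
      2 * r ≤ Module.finrank K V + 1 := by
  by_contra! hcon
  obtain ⟨hfail, hlt⟩ := hcon
  obtain ⟨U, hU⟩ := Submodule.exists_isCompl (imageSum X)
  have hn := Submodule.finrank_add_eq_of_isCompl hU.symm
  have hne := hX.exists_famComm_ne_zero hr
  have h1 := Submodule.finrank_lt_finrank_of_lt (hX.commImage_lt hne)
  by_cases hA : Module.finrank K (imageSum X) = Module.finrank K (commImage X) + 1
  · have := hX.two_mul_le_of_finrank_eq hr hU.symm hA hfail
    omega
  · have h2 := hfail (Module.finrank K U) (Module.finrank K (commImage X)) (by omega)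
    obtain ⟨z, hz, hz0, h⟩ := exists_ne_zero_map_le (U := U)
      (fun z hz v => apply_mem_commImage hz v) (⊥ : Submodule K (commImage X)) (by
        rwa [(Submodule.quotEquivOfEqBot _ rfl).finrank_eq])
    refine hz0 (hX.eq_zero_of_forall_mem hU.symm.sup_eq_top hz fun v hv => ?_)
    obtain ⟨w, hw, hzw⟩ := h v hv
    rw [hzw, (Submodule.mem_bot K).mp hw, Submodule.coe_zero]

end NilFamily

end LowerBound

/-! ### Representations as linear families with central commutators -/

section FaithfulRepresentations

universe u v

open FreeTwoStepNilpotent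

attribute [local instance 100] LieRing.ofAssociativeRing

variable {K : Type u} [Field K] {r : ℕ}

theorem finrank_exteriorSquare : Module.finrank K (⋀[K]^2 (Fin r → K)) = r.choose 2 := by
  rw [exteriorPower.finrank_eq, Module.finrank_fin_fun]

theorem finrank_freeTwoStepNilpotent :
    Module.finrank K (FreeTwoStepNilpotent K r) = r + r.choose 2 := by
  change Module.finrank K ((Fin r → K) × ⋀[K]^2 (Fin r → K)) = _
  rw [Module.finrank_prod, finrank_exteriorSquare, Module.finrank_fin_fun]

/-- The wedge of two linearly independent vectors is nonzero. -/
theorem wedge_ne_zero {x y : Fin r → K} (h : LinearIndependent K ![x, y]) : wedge x y ≠ 0 := by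
  have h1 := exteriorPower.ιMulti_family_linearIndependent_field (n := 2) h
  have h2 := h1.ne_zero (Set.powersetCard.ofFinEmbEquiv (RelEmbedding.refl _))
  rw [exteriorPower.ιMulti_family, Equiv.symm_apply_apply] at h2
  exact h2

theorem span_wedge : Submodule.span K
    (Set.range fun p : (Fin r → K) × (Fin r → K) => wedge p.1 p.2) = ⊤ := by
  rw [eq_top_iff, ← exteriorPower.ιMulti_span K 2 (Fin r → K)]
  refine Submodule.span_mono ?_
  rintro _ ⟨a, rfl⟩
  have h : ![a 0, a 1] = a := by funext i; fin_cases i <;> rfl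
  exact ⟨(a 0, a 1), congrArg (exteriorPower.ιMulti K 2) h⟩

variable {V : Type v} [AddCommGroup V] [Module K V]

/-- The restriction of a representation to the degree one part. -/
def degOne (π : FreeTwoStepNilpotent K r →ₗ⁅K⁆ Module.End K V) :
    (Fin r → K) →ₗ[K] Module.End K V :=
  (π : FreeTwoStepNilpotent K r →ₗ[K] Module.End K V) ∘ₗ
    LinearMap.inl K (Fin r → K) (⋀[K]^2 (Fin r → K))

/-- The restriction of a representation to the degree two part. -/
def degTwo (π : FreeTwoStepNilpotent K r →ₗ⁅K⁆ Module.End K V) :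
    ⋀[K]^2 (Fin r → K) →ₗ[K] Module.End K V :=
  (π : FreeTwoStepNilpotent K r →ₗ[K] Module.End K V) ∘ₗ
    LinearMap.inr K (Fin r → K) (⋀[K]^2 (Fin r → K))

theorem famComm_degOne (π : FreeTwoStepNilpotent K r →ₗ⁅K⁆ Module.End K V) (x y : Fin r → K) :
    famComm (degOne π) x y = degTwo π (wedge x y) :=
  (π.map_lie ((x, 0) : (Fin r → K) × ⋀[K]^2 (Fin r → K))
    ((y, 0) : (Fin r → K) × ⋀[K]^2 (Fin r → K))).symm

theorem commute_degTwo (π : FreeTwoStepNilpotent K r →ₗ⁅K⁆ Module.End K V)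
    (ω : ⋀[K]^2 (Fin r → K)) (x : Fin r → K) : Commute (degTwo π ω) (degOne π x) := by
  let a : FreeTwoStepNilpotent K r := ((0 : Fin r → K), ω)
  let b : FreeTwoStepNilpotent K r := (x, (0 : ⋀[K]^2 (Fin r → K)))
  have h0 : ⁅a, b⁆ = 0 := by
    rw [bracket_def, wedge_zero_left]; rfl
  have h := π.map_lie a b
  rw [h0, map_zero] at h
  exact sub_eq_zero.mp h.symm

/-- Lower bounds for the dimension of a faithful representation. -/
theorem faithful_estimate [CharZero K] [FiniteDimensional K V] (hr : 2 ≤ r)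
    (π : FreeTwoStepNilpotent K r →ₗ⁅K⁆ Module.End K V) (hπ : Function.Injective π) :
    (∃ a b, a + b + 2 ≤ Module.finrank K V ∧ r.choose 2 ≤ a * b) ∨
      2 * r ≤ Module.finrank K V + 1 := by
  have hinj : Function.Injective (degTwo π) := hπ.comp (LinearMap.inr_injective)
  obtain ⟨X, hnil, hcomm, hcent⟩ := exists_nilpotent_family (degOne π) (fun x y w => by
    rw [famComm_degOne]; exact commute_degTwo π _ w)
  have hX : NilFamily X := ⟨hnil, hcent, fun x y hxy h => by
    rw [hcomm, famComm_degOne, map_eq_zero_iff _ hinj] at h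
    exact wedge_ne_zero hxy h⟩
  have hZ : commSpan X = (degTwo π).range := by
    rw [LinearMap.range_eq_map, ← span_wedge, Submodule.map_span, commSpan, ← Set.range_comp]
    congr 2
    funext p
    rw [hcomm, famComm_degOne]; rfl
  have h := hX.finrank_estimate hr
  rwa [hZ, LinearMap.finrank_range_of_inj hinj, finrank_exteriorSquare] at h

/-- A linear family with central commutators defines a representation. -/
theorem exists_faithful (hr : 2 ≤ r) (X : (Fin r → K) →ₗ[K] Module.End K V)
    (hX : ∀ x y w, Commute (famComm X x y) (X w))
    (hinj : ∀ L : ⋀[K]^2 (Fin r → K) →ₗ[K] Module.End K V,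
      (∀ x y, L (wedge x y) = famComm X x y) → Function.Injective L) :
    ∃ π : FreeTwoStepNilpotent K r →ₗ⁅K⁆ Module.End K V, Function.Injective π := by
  let f : (Fin r → K) [⋀^Fin 2]→ₗ[K] Module.End K V :=
    { toFun := fun a => famComm X (a 0) (a 1)
      map_update_add' := fun a i x y => by
        fin_cases i <;> simp [famComm_add_left, famComm_add_right]
      map_update_smul' := fun a i t x => by
        fin_cases i <;> simp [famComm_smul_left, famComm_smul_right]
      map_eq_zero_of_eq' := fun a i j h hij => by
        fin_cases i <;> fin_cases j <;> simp_all [famComm] }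
  let L := exteriorPower.alternatingMapLinearEquiv f
  have hL : ∀ x y, L (wedge x y) = famComm X x y := fun x y => by
    simp [L, wedge, f]
  have hLi := hinj L hL
  have hLX : ∀ ω w, Commute (L ω) (X w) := by
    intro ω w
    have : ω ∈ Submodule.span K
        (Set.range fun p : (Fin r → K) × (Fin r → K) => wedge p.1 p.2) := by
      rw [span_wedge]; trivial
    induction this using Submodule.span_induction with
    | mem x h => obtain ⟨p, rfl⟩ := h; rw [hL]; exact hX _ _ _
    | zero => rw [map_zero]; exact Commute.zero_left _
    | add x y _ _ h1 h2 => rw [map_add]; exact h1.add_left h2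
    | smul t x _ h => rw [map_smul]; exact h.smul_left t
  have hLL : ∀ ω ω', Commute (L ω) (L ω') := by
    intro ω ω'
    have : ω' ∈ Submodule.span K
        (Set.range fun p : (Fin r → K) × (Fin r → K) => wedge p.1 p.2) := by
      rw [span_wedge]; trivial
    induction this using Submodule.span_induction with
    | mem x h =>
      obtain ⟨p, rfl⟩ := h
      rw [hL]
      exact ((hLX _ _).mul_right (hLX _ _)).sub_right ((hLX _ _).mul_right (hLX _ _))
    | zero => rw [map_zero]; exact Commute.zero_right _
    | add x y _ _ h1 h2 => rw [map_add]; exact h1.add_right h2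
    | smul t x _ h => rw [map_smul]; exact h.smul_right t
  let g : FreeTwoStepNilpotent K r →ₗ[K] Module.End K V :=
    LinearMap.coprod (M := Fin r → K) (M₂ := ⋀[K]^2 (Fin r → K)) X L
  have hg : ∀ x, g x = X x.1 + L x.2 := fun x => LinearMap.coprod_apply _ _ _
  let π : FreeTwoStepNilpotent K r →ₗ⁅K⁆ Module.End K V :=
    { g with
      map_lie' := fun {x y} => by
        change g ⁅x, y⁆ = g x * g y - g y * g x
        rw [hg, hg, hg, bracket_def]
        simp only [map_zero, zero_add, hL, famComm, add_mul, mul_add]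
        rw [(hLX x.2 y.1).eq, (hLX y.2 x.1).eq, (hLL x.2 y.2).eq]
        abel }
  refine ⟨π, (injective_iff_map_eq_zero (g : FreeTwoStepNilpotent K r →+ Module.End K V)).mpr ?_⟩
  intro a ha
  replace ha : X a.1 + L a.2 = 0 := (hg a).symm.trans ha
  have hXa : X a.1 = - L a.2 := eq_neg_of_add_eq_zero_left ha
  -- Here `X a.1` is central. For `y` independent of `a.1` this kills `L (a.1 ∧ y)`, against
  -- injectivity of `L`. So faithfulness on the degree two part suffices.
  have h1 : a.1 = 0 := by
    by_contra h0
    obtain ⟨y, hy⟩ := exists_linearIndependent_pair_of_one_lt_rank (R := K) (M := Fin r → K)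
      (by rw [rank_fin_fun]; exact_mod_cast hr) h0
    refine wedge_ne_zero hy (hLi ?_)
    rw [hL, map_zero, famComm, hXa, neg_mul, mul_neg, (hLX a.2 y).eq]
    simp
  have h2 : a.2 = 0 := hLi (by rw [map_zero]; rwa [h1, map_zero, zero_add] at ha)
  exact Prod.ext h1 h2

end FaithfulRepresentations

/-! ### Block representations and alternating matrices -/

section BlockRepresentations

universe u

open FreeTwoStepNilpotent

attribute [local instance 100] LieRing.ofAssociativeRing

variable {K : Type u} [Field K] {r : ℕ}

theorem linearMap_ext_wedge {F : Type*} [AddCommGroup F] [Module K F]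
    {f g : ⋀[K]^2 (Fin r → K) →ₗ[K] F} (h : ∀ x y, f (wedge x y) = g (wedge x y)) : f = g :=
  LinearMap.ext_on span_wedge (by rintro _ ⟨p, rfl⟩; exact h _ _)

/-- The alternating matrix of a bivector. -/
noncomputable def wedgeMatrix : ⋀[K]^2 (Fin r → K) →ₗ[K] Matrix (Fin r) (Fin r) K :=
  exteriorPower.alternatingMapLinearEquiv
    { toFun := fun a => Matrix.vecMulVec (a 0) (a 1) - Matrix.vecMulVec (a 1) (a 0)
      map_update_add' := fun a i x y => by
        fin_cases i <;> simp [Matrix.add_vecMulVec, Matrix.vecMulVec_add] <;> abel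
      map_update_smul' := fun a i t x => by
        fin_cases i <;> simp [Matrix.smul_vecMulVec, Matrix.vecMulVec_smul, smul_sub]
      map_eq_zero_of_eq' := fun a i j h hij => by
        fin_cases i <;> fin_cases j <;> simp_all }

theorem wedgeMatrix_wedge (x y : Fin r → K) :
    wedgeMatrix (wedge x y) = Matrix.vecMulVec x y - Matrix.vecMulVec y x := by
  simp [wedgeMatrix, wedge]

theorem wedgeMatrix_apply_self (ω : ⋀[K]^2 (Fin r → K)) (x : Fin r) : wedgeMatrix ω x x = 0 := by
  have h : Matrix.entryLinearMap K K x x ∘ₗ (wedgeMatrix (K := K) (r := r)) = 0 :=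
    linearMap_ext_wedge fun a b => by
      simp [wedgeMatrix_wedge, Matrix.vecMulVec_apply, mul_comm]
  exact LinearMap.congr_fun h ω

theorem wedgeMatrix_apply_swap (ω : ⋀[K]^2 (Fin r → K)) (x y : Fin r) :
    wedgeMatrix ω x y = - wedgeMatrix ω y x := by
  have h : Matrix.entryLinearMap K K x y ∘ₗ (wedgeMatrix (K := K) (r := r)) =
      - (Matrix.entryLinearMap K K y x ∘ₗ wedgeMatrix) :=
    linearMap_ext_wedge fun a b => by
      simp [wedgeMatrix_wedge, Matrix.vecMulVec_apply, mul_comm]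
  exact LinearMap.congr_fun h ω

/-- Each coordinate of a bivector in the standard basis of the exterior square is an entry of its
matrix. -/
theorem wedgeMatrix_injective : Function.Injective (wedgeMatrix (K := K) (r := r)) := by
  refine (injective_iff_map_eq_zero _).mpr fun ω hω => ?_
  refine (Module.Basis.exteriorPower 2 (Pi.basisFun K (Fin r))).ext_elem fun s => ?_
  rw [exteriorPower.basis_repr_apply, map_zero, Finsupp.zero_apply]
  have h : exteriorPower.ιMultiDual K 2 (Pi.basisFun K (Fin r)) s =
      Matrix.entryLinearMap K K (Set.powersetCard.ofFinEmbEquiv.symm s 0)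
        (Set.powersetCard.ofFinEmbEquiv.symm s 1) ∘ₗ wedgeMatrix :=
    linearMap_ext_wedge fun a b => by
      simp only [LinearMap.comp_apply, Matrix.entryLinearMap_apply, wedgeMatrix_wedge]
      rw [wedge, exteriorPower.ιMultiDual_apply_ιMulti, Matrix.det_fin_two]
      simp [Matrix.vecMulVec_apply, mul_comm]
  rw [h, LinearMap.comp_apply, hω, map_zero]

/-- The property that matrices `A k`, `B k` separate alternating matrices. -/
def SeparatesAlternating {p q s : Type*} [Fintype q] (A : q → Matrix p (Fin r) K)
    (B : q → Matrix (Fin r) s K) : Prop :=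
  ∀ M : Matrix (Fin r) (Fin r) K, (∀ x, M x x = 0) → (∀ x y, M x y = - M y x) →
    ∑ k, A k * M * B k = 0 → M = 0

open scoped Matrix in
/-- The family of block operators attached to matrices `A k` and `B k`. -/
def blockFamily {p q s : ℕ} (A : Fin q → Matrix (Fin p) (Fin r) K)
    (B : Fin q → Matrix (Fin r) (Fin s) K) :
    (Fin r → K) →ₗ[K] Module.End K ((Fin p → K) × (Fin q → K) × (Fin s → K)) :=
  LinearMap.mk₂ K
    (fun u v => (∑ k, v.2.1 k • (A k *ᵥ u), fun k => (u ᵥ* B k) ⬝ᵥ v.2.2, 0))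
    (fun u u' v => by
      ext <;> simp [Matrix.mulVec_add, Matrix.add_vecMul, Finset.sum_add_distrib])
    (fun t u v => by
      ext <;> simp [Matrix.mulVec_smul, Matrix.smul_vecMul, Finset.mul_sum, mul_left_comm])
    (fun u v v' => by
      ext <;> simp [Finset.sum_add_distrib, add_mul])
    (fun t u v => by
      ext <;> simp [Finset.mul_sum, mul_assoc])

open scoped Matrix in
theorem famComm_blockFamily_apply {p q s : ℕ} (A : Fin q → Matrix (Fin p) (Fin r) K)
    (B : Fin q → Matrix (Fin r) (Fin s) K) (x y : Fin r → K)
    (v : (Fin p → K) × (Fin q → K) × (Fin s → K)) :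
    famComm (blockFamily A B) x y v =
      (∑ k, (((y ᵥ* B k) ⬝ᵥ v.2.2) • (A k *ᵥ x) - ((x ᵥ* B k) ⬝ᵥ v.2.2) • (A k *ᵥ y)), 0, 0) := by
  ext <;> simp [famComm, blockFamily, Finset.sum_sub_distrib]

open scoped Matrix in
/-- Matrices that separate alternating matrices give a faithful representation. -/
theorem SeparatesAlternating.exists_faithful (hr : 2 ≤ r) {p q s : ℕ}
    {A : Fin q → Matrix (Fin p) (Fin r) K} {B : Fin q → Matrix (Fin r) (Fin s) K}
    (h : SeparatesAlternating A B) :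
    ∃ (V : Type u) (_ : AddCommGroup V) (_ : Module K V) (_ : FiniteDimensional K V)
      (π : FreeTwoStepNilpotent K r →ₗ⁅K⁆ Module.End K V),
      Function.Injective π ∧ Module.finrank K V = p + q + s := by
  obtain ⟨π, hπ⟩ := _root_.exists_faithful hr (blockFamily A B) (fun x y w => by
    refine LinearMap.ext fun v => ?_
    rw [Module.End.mul_apply, Module.End.mul_apply, famComm_blockFamily_apply,
      famComm_blockFamily_apply]
    ext <;> simp [blockFamily]) (fun L hL => by
    refine (injective_iff_map_eq_zero _).mpr fun ω hω => ?_
    refine (injective_iff_map_eq_zero _).mp wedgeMatrix_injective ω ?_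
    refine h _ (wedgeMatrix_apply_self ω) (wedgeMatrix_apply_swap ω) ?_
    ext i j
    -- `f` reads the `(i, j)` entry of the block `K^s → K^p` of `L ω`, and `g` that of `∑ k, A k * M
    -- * B k`; they agree on wedges.
    let f : ⋀[K]^2 (Fin r → K) →ₗ[K] K := LinearMap.proj i ∘ₗ LinearMap.fst K _ _ ∘ₗ
      LinearMap.applyₗ ((0, 0, Pi.single j 1) : (Fin p → K) × (Fin q → K) × (Fin s → K)) ∘ₗ L
    let g : ⋀[K]^2 (Fin r → K) →ₗ[K] K := Matrix.entryLinearMap K K i j ∘ₗ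
      (∑ k, (mulRightLinearMap (Fin p) K (B k)) ∘ₗ
        (mulLeftLinearMap (Fin r) K (A k))) ∘ₗ wedgeMatrix
    have hfg : f = g := linearMap_ext_wedge fun x y => by
      simp [f, g, hL, famComm_blockFamily_apply, wedgeMatrix_wedge, Matrix.mul_sub, Matrix.sub_mul,
        Matrix.mul_vecMulVec, Matrix.vecMulVec_mul, Matrix.vecMulVec_apply, Matrix.sum_apply,
        Finset.sum_apply, mul_comm]
    have hf : f ω = 0 := by simp [f, hω]
    have hg : g ω = (∑ k, A k * wedgeMatrix ω * B k) i j := by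
      simp [g, Matrix.sum_apply]
    rw [← hg, ← hfg, hf]; rfl)
  refine ⟨_, _, _, inferInstance, π, hπ, ?_⟩
  simp [add_assoc]

end BlockRepresentations

/-! ### Integer matrices and lifting from a prime field -/

section Lifting

variable {r : ℕ}

/-- Consecutive coordinates separate alternating matrices. -/
theorem separatesAlternating_consecutive (K : Type*) [Field K] (n : ℕ) :
    SeparatesAlternating (r := n + 1)
      (fun _ : Fin 1 => (Matrix.of fun i x => if x = i.castSucc then (1 : K) else 0 :
        Matrix (Fin n) (Fin (n + 1)) K))
      (fun _ => (Matrix.of fun x j => if x = j.succ then (1 : K) else 0 :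
        Matrix (Fin (n + 1)) (Fin n) K)) := by
  intro M hdiag hswap h
  -- `A` drops the last row of `M` and `B` the first column, so every entry above the diagonal
  -- survives.
  have hlt : ∀ x y, x < y → M x y = 0 := by
    intro x y hxy
    obtain ⟨i, rfl⟩ := Fin.exists_castSucc_eq.mpr (hxy.trans_le (Fin.le_last y)).ne
    obtain ⟨j, rfl⟩ := Fin.exists_succ_eq.mpr ((Fin.zero_le _).trans_lt hxy).ne'
    have := congrFun (congrFun h i) j
    simpa [Matrix.mul_apply] using this
  ext x y
  rcases lt_trichotomy x y with hxy | rfl | hxy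
  · exact hlt x y hxy
  · exact hdiag x
  · rw [hswap, hlt y x hxy]; simp

/-- The alternating matrix with prescribed entries above the diagonal. -/
def altMatrix {R : Type*} [CommRing R] (m : {t : Fin r × Fin r // t.1 < t.2} → R) :
    Matrix (Fin r) (Fin r) R :=
  Matrix.of fun x y =>
    if h : x < y then m ⟨(x, y), h⟩ else if h : y < x then - m ⟨(y, x), h⟩ else 0

theorem altMatrix_eq_sum {R : Type*} [CommRing R] (m : {t : Fin r × Fin r // t.1 < t.2} → R) :
    altMatrix m = ∑ t, m t • (Matrix.single t.1.1 t.1.2 1 - Matrix.single t.1.2 t.1.1 1) := by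
  ext x y
  simp only [altMatrix, Matrix.of_apply, Matrix.sum_apply, Matrix.smul_apply, Matrix.sub_apply,
    Matrix.single_apply]
  rcases lt_trichotomy x y with hxy | rfl | hxy
  · rw [Finset.sum_eq_single (⟨(x, y), hxy⟩ : {t : Fin r × Fin r // t.1 < t.2})]
    · simp [hxy, hxy.ne']
    · rintro ⟨⟨a, b⟩, hab⟩ - hne
      have h1 : ¬ (a = x ∧ b = y) := fun h => hne (by simp [h.1, h.2])
      have h2 : ¬ (b = x ∧ a = y) := fun h => by
        simp only at hab; omega
      simp [h1, h2]
    · simp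
  · rw [Finset.sum_eq_zero]
    · simp
    · rintro ⟨⟨a, b⟩, hab⟩ -
      have h1 : ¬ (a = x ∧ b = x) := fun h => by simp only at hab; omega
      have h2 : ¬ (b = x ∧ a = x) := fun h => by simp only at hab; omega
      simp [h1, h2]
  · rw [Finset.sum_eq_single (⟨(y, x), hxy⟩ : {t : Fin r × Fin r // t.1 < t.2})]
    · simp [hxy, hxy.ne', hxy.not_gt]
    · rintro ⟨⟨a, b⟩, hab⟩ - hne
      have h1 : ¬ (b = x ∧ a = y) := fun h => hne (by simp [h.1, h.2])
      have h2 : ¬ (a = x ∧ b = y) := fun h => by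
        simp only at hab; omega
      simp [h1, h2]
    · simp

theorem eq_altMatrix {R : Type*} [CommRing R] {M : Matrix (Fin r) (Fin r) R}
    (hdiag : ∀ x, M x x = 0) (hswap : ∀ x y, M x y = - M y x) :
    M = altMatrix fun t => M t.1.1 t.1.2 := by
  ext x y
  rcases lt_trichotomy x y with hxy | rfl | hxy
  · simp [altMatrix, hxy]
  · simp [altMatrix, hdiag]
  · simp [altMatrix, hxy, hxy.not_gt, ← hswap x y]

/-- The matrix of `M ↦ ∑ A k * M * B k` on alternating matrices. -/
def sepMatrix {R : Type*} [CommRing R] {p q s : Type*} [Fintype q] (A : q → Matrix p (Fin r) R)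
    (B : q → Matrix (Fin r) s R) : Matrix (p × s) {t : Fin r × Fin r // t.1 < t.2} R :=
  Matrix.of fun ij t =>
    ∑ k, (A k ij.1 t.1.1 * B k t.1.2 ij.2 - A k ij.1 t.1.2 * B k t.1.1 ij.2)

theorem sepMatrix_mulVec {R : Type*} [CommRing R] {p q s : Type*} [Fintype q]
    (A : q → Matrix p (Fin r) R) (B : q → Matrix (Fin r) s R)
    (m : {t : Fin r × Fin r // t.1 < t.2} → R) (i : p) (j : s) :
    (sepMatrix A B).mulVec m (i, j) = (∑ k, A k * altMatrix m * B k) i j := by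
  classical
  have key : ∀ k (a b : Fin r),
      (A k * (Matrix.single a b 1 : Matrix (Fin r) (Fin r) R) * B k) i j = A k i a * B k b j := by
    intro k a b
    rw [Matrix.mul_apply, Finset.sum_eq_single b]
    · simp
    · intro c _ hc; simp [Matrix.mul_single_apply_of_ne, hc]
    · simp
  simp only [Matrix.mulVec, dotProduct, sepMatrix, Matrix.of_apply, altMatrix_eq_sum,
    Matrix.mul_sum, Matrix.sum_mul, Matrix.sum_apply, Matrix.mul_smul, Matrix.smul_mul,
    Matrix.smul_apply, Matrix.mul_sub, Matrix.sub_mul, Matrix.sub_apply, key]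
  rw [Finset.sum_comm]
  refine Finset.sum_congr rfl fun t _ => ?_
  rw [Finset.sum_mul]
  exact Finset.sum_congr rfl fun k _ => by rw [smul_eq_mul, mul_comm]

/-- Separation becomes triviality of the kernel of a matrix whose entries are integer polynomials in
those of `A` and `B`, a form compatible with ring homomorphisms. -/
theorem separatesAlternating_iff {K : Type*} [Field K] {p q s : Type*} [Fintype q]
    (A : q → Matrix p (Fin r) K) (B : q → Matrix (Fin r) s K) :
    SeparatesAlternating A B ↔ ∀ m, (sepMatrix A B).mulVec m = 0 → m = 0 := by
  constructor
  · intro h m hm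
    have h1 : altMatrix m = 0 := by
      refine h _ (fun x => by simp [altMatrix]) (fun x y => ?_) ?_
      · rcases lt_trichotomy x y with hxy | rfl | hxy
        · simp [altMatrix, hxy, hxy.not_gt]
        · simp [altMatrix]
        · simp [altMatrix, hxy, hxy.not_gt]
      · ext i j
        rw [← sepMatrix_mulVec, hm]; rfl
    funext t
    have := congrFun (congrFun h1 t.1.1) t.1.2
    simpa [altMatrix, t.2] using this
  · intro h M hdiag hswap hM
    rw [eq_altMatrix hdiag hswap] at hM ⊢
    rw [h (fun t => M t.1.1 t.1.2)]
    · ext; simp [altMatrix]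
    · funext ij
      rw [← Prod.mk.eta (p := ij), sepMatrix_mulVec, hM]; rfl

/-- A matrix with trivial kernel has a left inverse. -/
theorem exists_mul_eq_one_of_mulVec {K : Type*} [Field K] {m n : Type*} [Fintype m] [DecidableEq m]
    [Fintype n] [DecidableEq n] (M : Matrix m n K) (h : ∀ v, M.mulVec v = 0 → v = 0) :
    ∃ L : Matrix n m K, L * M = 1 := by
  obtain ⟨g, hg⟩ := LinearMap.exists_leftInverse_of_injective (Matrix.toLin' M)
    (LinearMap.ker_eq_bot'.mpr h)
  refine ⟨LinearMap.toMatrix' g, ?_⟩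
  have := congrArg LinearMap.toMatrix' hg
  rwa [LinearMap.toMatrix'_comp, LinearMap.toMatrix'_toLin', LinearMap.toMatrix'_id] at this

theorem sepMatrix_map {R S : Type*} [CommRing R] [CommRing S] (f : R →+* S) {p q s : Type*}
    [Fintype q] (A : q → Matrix p (Fin r) R) (B : q → Matrix (Fin r) s R) :
    (sepMatrix A B).map f = sepMatrix (fun k => (A k).map f) (fun k => (B k).map f) := by
  ext ij t
  simp [sepMatrix]

/-- Separating matrices modulo a prime lift to characteristic zero. -/
theorem exists_separatesAlternating_of_zmod {ℓ : ℕ} [Fact ℓ.Prime] (K : Type*) [Field K]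
    [CharZero K] {p q s : Type*} [Fintype p] [Fintype q] [Fintype s]
    (h : ∃ (A : q → Matrix p (Fin r) (ZMod ℓ)) (B : q → Matrix (Fin r) s (ZMod ℓ)),
      SeparatesAlternating A B) :
    ∃ (A : q → Matrix p (Fin r) K) (B : q → Matrix (Fin r) s K), SeparatesAlternating A B := by
  classical
  obtain ⟨A, B, hAB⟩ := h
  rw [separatesAlternating_iff] at hAB
  obtain ⟨L, hL⟩ := exists_mul_eq_one_of_mulVec _ hAB
  let A' : q → Matrix p (Fin r) ℤ := fun k => (A k).map ZMod.cast
  let B' : q → Matrix (Fin r) s ℤ := fun k => (B k).map ZMod.cast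
  let L' : Matrix {t : Fin r × Fin r // t.1 < t.2} (p × s) ℤ := L.map ZMod.cast
  -- `L'` lifts a left inverse modulo `ℓ`, so this integer determinant is 1 modulo `ℓ` and remains
  -- nonzero in `K`.
  have hdet : (L' * sepMatrix A' B').det ≠ 0 := by
    intro h0
    have h1 := congrArg (Int.castRingHom (ZMod ℓ)) h0
    rw [RingHom.map_det, RingHom.mapMatrix_apply, Matrix.map_mul, sepMatrix_map] at h1
    have e1 : L'.map (Int.castRingHom (ZMod ℓ)) = L := by ext; simp [L']
    have e2 : (fun k => (A' k).map (Int.castRingHom (ZMod ℓ))) = A := by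
      funext k; ext; simp [A']
    have e3 : (fun k => (B' k).map (Int.castRingHom (ZMod ℓ))) = B := by
      funext k; ext; simp [B']
    rw [e1, e2, e3, hL, Matrix.det_one, map_zero] at h1
    exact one_ne_zero h1
  refine ⟨fun k => (A' k).map (Int.castRingHom K), fun k => (B' k).map (Int.castRingHom K), ?_⟩
  rw [separatesAlternating_iff]
  intro m hm
  refine Matrix.eq_zero_of_mulVec_eq_zero (M := (L' * sepMatrix A' B').map (Int.castRingHom K)) ?_ ?_
  · rw [← RingHom.mapMatrix_apply, ← RingHom.map_det]
    simpa using hdet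
  · rw [Matrix.map_mul, sepMatrix_map, ← Matrix.mulVec_mulVec, hm, Matrix.mulVec_zero]

end Lifting

/-! ### Counting degenerate matrices over a finite field -/

section Counting

variable {F : Type*} [Field F]

/-- A set of rows that is a basis of the row space. -/
structure IsRowBasis {n s : Type*} (Z : Matrix n s F) (I : Finset n) : Prop where
  indep : LinearIndependent F fun i : I => Z i
  span : ∀ a, ∃ c : I → F, Z a = ∑ i, c i • Z i

theorem exists_isRowBasis {n s : Type*} [Fintype n] (Z : Matrix n s F) :
    ∃ I, IsRowBasis Z I := by
  classical
  obtain ⟨b, -, -, hspan, hind⟩ := exists_linearIndepOn_extension (v := fun a => Z a)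
    (linearIndepOn_empty F _) (Set.empty_subset (Set.univ : Set n))
  refine ⟨b.toFinset, ?_, fun a => ?_⟩
  · have : (b.toFinset : Set n) = b := by simp
    rw [← this] at hind
    exact hind
  · have h1 : Z a ∈ Submodule.span F (Set.range fun i : b.toFinset => Z i) := by
      have h2 := hspan ⟨a, Set.mem_univ a, rfl⟩
      have h3 : (Set.range fun i : b.toFinset => Z i) = (fun a => Z a) '' b := by
        ext x; simp
      rw [h3]
      exact h2
    obtain ⟨c, hc⟩ := (Submodule.mem_span_range_iff_exists_fun F).mp h1
    exact ⟨c, hc.symm⟩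

theorem IsRowBasis.card_le {n s : Type*} [Fintype s] {Z : Matrix n s F} {I : Finset n}
    (h : IsRowBasis Z I) : I.card ≤ Fintype.card s := by
  have := h.indep.fintype_card_le_finrank
  simpa using this

/-- The fibres of a surjective linear map have the same size. -/
theorem card_preimage_mul_card {G H : Type*} [AddCommGroup G] [Module F G] [AddCommGroup H]
    [Module F H] (φ : G →ₗ[F] H) (hφ : Function.Surjective φ) (P : H → Prop) :
    Nat.card {g // P (φ g)} * Nat.card H = Nat.card G * Nat.card {h // P h} := by
  let σ := Function.surjInv hφ
  have hσ : ∀ h, φ (σ h) = h := Function.surjInv_eq hφ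
  let e : G ≃ H × φ.ker :=
    { toFun := fun g => (φ g, ⟨g - σ (φ g), by simp [hσ]⟩)
      invFun := fun x => x.2 + σ x.1
      left_inv := fun g => by simp
      right_inv := fun x => by
        have hx : φ (x.2 : G) = 0 := x.2.2
        ext <;> simp [hσ, hx] }
  let e' : {g // P (φ g)} ≃ {h // P h} × φ.ker :=
    (e.subtypeEquiv (p := fun g => P (φ g)) (q := fun x => P x.1) fun g => Iff.rfl).trans
      (Equiv.prodSubtypeFstEquivSubtypeProd (p := P))
  rw [Nat.card_congr e', Nat.card_congr e, Nat.card_prod, Nat.card_prod]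
  ring

theorem card_matrix {F m n : Type*} [Fintype m] [Fintype n] :
    Nat.card (Matrix m n F) = Nat.card F ^ (Fintype.card m * Fintype.card n) := by
  change Nat.card (m → n → F) = _
  rw [Nat.card_fun, Nat.card_fun, ← pow_mul, mul_comm]; simp

/-- The number of matrices annihilating a matrix with a given row basis. -/
theorem card_annihilating_mul {p r s κ : Type*} [Fintype p] [Fintype r] [Fintype s] [Fintype κ]
    {M : Matrix r r F} {J : Finset r} (hJ : IsRowBasis M J) :
    Nat.card {θ : (κ → Matrix p r F) × (κ → Matrix r s F) // ∑ k, θ.1 k * M * θ.2 k = 0}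
        * Nat.card F ^ (Fintype.card κ * J.card * (Fintype.card p + Fintype.card s)) =
      Nat.card F ^ (Fintype.card κ * Fintype.card r * (Fintype.card p + Fintype.card s)) *
        Nat.card {x : Matrix p (κ × J) F × Matrix (κ × J) s F // x.1 * x.2 = 0} := by
  classical
  choose c hc using hJ.span
  let W : Matrix J r F := Matrix.of fun i => M i
  let U : Matrix r J F := Matrix.of c
  have hM : M = U * W := by
    ext a b
    have := congrFun (hc a) b
    simpa [Matrix.mul_apply, U, W] using this
  obtain ⟨U', hU'⟩ : ∃ U' : Matrix J r F, U' * U = 1 := by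
    refine ⟨Matrix.of fun i a => if a = i then 1 else 0, ?_⟩
    ext i j
    have hUi : ∀ i j : J, U i j = if i = j then 1 else 0 := by
      intro i j
      have h1 : ∑ j : J, (c i j - if i = j then 1 else 0) • M j = 0 := by
        simp only [sub_smul, Finset.sum_sub_distrib, ← hc, ite_smul, one_smul, zero_smul,
          Finset.sum_ite_eq, Finset.mem_univ, if_true, sub_self]
      exact sub_eq_zero.mp (Fintype.linearIndependent_iff.mp hJ.indep _ h1 j)
    simp [Matrix.mul_apply, hUi, Matrix.one_apply]
  obtain ⟨W', hW'⟩ : ∃ W' : Matrix r J F, W * W' = 1 := by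
    obtain ⟨L, hL⟩ := exists_mul_eq_one_of_mulVec W.transpose (fun v hv => by
      funext i
      refine Fintype.linearIndependent_iff.mp hJ.indep v ?_ i
      funext b
      have := congrFun hv b
      simpa [Matrix.mulVec, dotProduct, W, mul_comm] using this)
    exact ⟨L.transpose, by rw [← Matrix.transpose_inj, Matrix.transpose_mul]; simpa using hL⟩
  -- With the rank factorization `M = U * W`, only the products `A k * U` and `W * B k` matter.
  -- Placing them side by side turns the sum over `k` into one matrix product.
  let Φ : (κ → Matrix p r F) × (κ → Matrix r s F) →ₗ[F]
      Matrix p (κ × J) F × Matrix (κ × J) s F :=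
    { toFun := fun θ => (Matrix.of fun i e => (θ.1 e.1 * U) i e.2,
        Matrix.of fun e j => (W * θ.2 e.1) e.2 j)
      map_add' := fun x y => by ext <;> simp [Matrix.add_mul, Matrix.mul_add]
      map_smul' := fun t x => by ext <;> simp }
  have hΦ : Function.Surjective Φ := by
    rintro ⟨Y, Z⟩
    refine ⟨(fun k => Matrix.of (fun i j => Y i (k, j)) * U',
      fun k => W' * Matrix.of fun i j => Z (k, i) j), ?_⟩
    ext
    · simp [Φ, Matrix.mul_assoc, hU']
    · simp [Φ, ← Matrix.mul_assoc, hW']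
  have h := card_preimage_mul_card Φ hΦ fun x => x.1 * x.2 = 0
  have hP : ∀ θ : (κ → Matrix p r F) × (κ → Matrix r s F),
      (Φ θ).1 * (Φ θ).2 = ∑ k, θ.1 k * M * θ.2 k := by
    intro θ
    ext i j
    simp only [Φ, hM, Matrix.sum_apply]
    rw [Matrix.mul_apply, Fintype.sum_prod_type]
    refine Finset.sum_congr rfl fun k _ => ?_
    rw [← Matrix.mul_assoc, Matrix.mul_assoc, Matrix.mul_apply]
    rfl
  simp only [hP] at h
  rw [Nat.card_prod, Nat.card_prod, Nat.card_fun, Nat.card_fun, card_matrix, card_matrix,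
    card_matrix, card_matrix, ← pow_mul, ← pow_mul, ← pow_add, ← pow_add] at h
  simp only [Fintype.card_prod, Fintype.card_coe, Nat.card_eq_fintype_card (α := κ)] at h
  convert h using 3 <;> ring

variable [Finite F]

/-- Pairs of matrices with product zero are determined by few entries. -/
theorem card_pairs_isRowBasis_le {p n s : Type*} [Fintype p] [Fintype n] [Fintype s]
    (I : Finset n) :
    Nat.card {x : Matrix p n F × Matrix n s F // x.1 * x.2 = 0 ∧ IsRowBasis x.2 I} ≤
      Nat.card F ^ (I.card * Fintype.card s + (Fintype.card n - I.card) * I.card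
        + Fintype.card p * (Fintype.card n - I.card)) := by
  classical
  let T := {x : Matrix p n F × Matrix n s F // x.1 * x.2 = 0 ∧ IsRowBasis x.2 I}
  choose c hc using fun x : T => x.2.2.span
  -- Stored are the basis rows of the second factor, the coefficients of its other rows, and the
  -- columns of the first factor outside `I`. The columns in `I` are then forced, as the basis rows
  -- are independent.
  let f : T → ((I × s → F) × ({a // a ∉ I} × I → F)) × (p × {a // a ∉ I} → F) := fun x =>
    ((fun e => x.1.2 e.1 e.2, fun e => c x e.1 e.2), fun e => x.1.1 e.1 e.2)
  have hf : Function.Injective f := by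
    intro x y hxy
    have e1 : ∀ (i : I) j, x.1.2 i j = y.1.2 i j := fun i j =>
      congrFun (congrArg (fun w => w.1.1) hxy) (i, j)
    have e2 : ∀ a (ha : a ∉ I) i, c x a i = c y a i := fun a ha i =>
      congrFun (congrArg (fun w => w.1.2) hxy) (⟨a, ha⟩, i)
    have e3 : ∀ k a (_ : a ∉ I), x.1.1 k a = y.1.1 k a := fun k a ha =>
      congrFun (congrArg (fun w => w.2) hxy) (k, ⟨a, ha⟩)
    have e1' : ∀ i : I, x.1.2 i = y.1.2 i := fun i => funext (e1 i)
    have hZ : x.1.2 = y.1.2 := by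
      funext a
      by_cases ha : a ∈ I
      · exact e1' ⟨a, ha⟩
      · rw [hc x a, hc y a]
        exact Finset.sum_congr rfl fun i _ => by rw [e2 a ha, e1']
    have hY : x.1.1 = y.1.1 := by
      ext k a
      by_cases ha : a ∈ I
      swap
      · exact e3 k a ha
      have h0 : ∑ i : I, (x.1.1 k i - y.1.1 k i) • x.1.2 i = 0 := by
        have h1 : ∑ b, (x.1.1 k b - y.1.1 k b) • x.1.2 b = 0 := by
          funext j
          have hx := congrFun (congrFun x.2.1 k) j
          have hy := congrFun (congrFun y.2.1 k) j
          rw [← hZ] at hy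
          simp only [Matrix.mul_apply, Matrix.zero_apply] at hx hy
          simp [sub_mul, Finset.sum_sub_distrib, hx, hy]
        rw [← Finset.sum_subset (Finset.subset_univ I) (fun b _ hb => by
          rw [e3 k b hb, sub_self, zero_smul])] at h1
        rw [← h1, ← Finset.sum_coe_sort I]
      exact sub_eq_zero.mp (Fintype.linearIndependent_iff.mp x.2.2.indep _ h0 ⟨a, ha⟩)
    exact Subtype.ext (Prod.ext hY hZ)
  refine (Nat.card_le_card_of_injective f hf).trans_eq ?_
  have hcard : Nat.card {a // a ∉ I} = Fintype.card n - I.card := by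
    rw [Nat.card_eq_fintype_card, Fintype.card_subtype_compl]; simp
  rw [Nat.card_prod, Nat.card_prod, Nat.card_fun, Nat.card_fun, Nat.card_fun, Nat.card_prod,
    Nat.card_prod, Nat.card_prod, hcard, ← pow_add, ← pow_add]
  simp

/-- A bound for the number of pairs of matrices with product zero. -/
theorem card_pairs_mul_le {p n s : Type*} [Fintype p] [Fintype n] [Fintype s] (d : ℕ)
    (hexp : ∀ k ≤ Fintype.card n, k ≤ Fintype.card s →
      k * Fintype.card s + (Fintype.card n - k) * k + Fintype.card p * (Fintype.card n - k) + d ≤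
        Fintype.card n * (Fintype.card p + Fintype.card s)) :
    Nat.card {x : Matrix p n F × Matrix n s F // x.1 * x.2 = 0} * Nat.card F ^ d ≤
      2 ^ Fintype.card n *
        Nat.card F ^ (Fintype.card n * (Fintype.card p + Fintype.card s)) := by
  classical
  choose I hI using fun Z : Matrix n s F => exists_isRowBasis Z
  let g : {x : Matrix p n F × Matrix n s F // x.1 * x.2 = 0} →
      Σ I : Finset n, {x : Matrix p n F × Matrix n s F // x.1 * x.2 = 0 ∧ IsRowBasis x.2 I} :=
    fun x => ⟨I x.1.2, x.1, x.2, hI _⟩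
  have hg : Function.Injective g := by
    intro x y hxy
    have h : ∀ a b : Σ I : Finset n,
        {x : Matrix p n F × Matrix n s F // x.1 * x.2 = 0 ∧ IsRowBasis x.2 I},
        a = b → a.2.1 = b.2.1 := by rintro a _ rfl; rfl
    exact Subtype.ext (h _ _ hxy)
  have h1 := Nat.card_le_card_of_injective g hg
  rw [Nat.card_sigma] at h1
  refine (Nat.mul_le_mul_right _ h1).trans ?_
  rw [Finset.sum_mul, ← Fintype.card_finset (α := n), ← Finset.card_univ, ← smul_eq_mul,
    ← Finset.sum_const]
  refine Finset.sum_le_sum fun I _ => ?_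
  have hQ : 0 < Nat.card F := Nat.card_pos
  by_cases hIs : I.card ≤ Fintype.card s
  · refine (Nat.mul_le_mul_right _ (card_pairs_isRowBasis_le I)).trans ?_
    rw [← pow_add]
    exact Nat.pow_le_pow_right hQ (hexp _ (Finset.card_le_univ I) hIs)
  -- The rank cannot exceed the number of columns, so `hexp` is not needed here.
  · have : IsEmpty {x : Matrix p n F × Matrix n s F // x.1 * x.2 = 0 ∧ IsRowBasis x.2 I} :=
      ⟨fun x => hIs x.2.2.card_le⟩
    simp

/-- The number of alternating matrices with a given row basis. -/
theorem card_alternating_isRowBasis_le {r : Type*} [Fintype r] (J : Finset r) :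
    Nat.card {M : Matrix r r F // ((∀ x, M x x = 0) ∧ (∀ x y, M x y = - M y x)) ∧
      IsRowBasis M J} ≤
      Nat.card F ^ (J.card.choose 2 + J.card * (Fintype.card r - J.card)) := by
  classical
  let T := {M : Matrix r r F // ((∀ x, M x x = 0) ∧ (∀ x y, M x y = - M y x)) ∧ IsRowBasis M J}
  -- The rows in `J` determine `M`. Their `J × J` block is stored once per unordered pair, in an
  -- arbitrary chosen orientation.
  let f : T → ({e : Sym2 J // ¬ e.IsDiag} → F) × (J × {y // y ∉ J} → F) := fun M =>
    (fun e => M.1 (Quot.out e.1).1 (Quot.out e.1).2, fun e => M.1 e.1 e.2)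
  have hf : Function.Injective f := by
    intro M N hMN
    have hJJ : ∀ x : J, ∀ y, M.1 x y = N.1 x y := by
      intro x y
      by_cases hy : y ∈ J
      · by_cases hxy : x = ⟨y, hy⟩
        · rw [hxy, M.2.1.1, N.2.1.1]
        · have h1 := congrFun (congrArg Prod.fst hMN)
            (⟨s(x, ⟨y, hy⟩), by rwa [Sym2.mk_isDiag_iff]⟩ : {e : Sym2 J // ¬ e.IsDiag})
          simp only [f] at h1
          have h2 : Sym2.mk (Quot.out s(x, ⟨y, hy⟩)).1 (Quot.out s(x, ⟨y, hy⟩)).2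
              = s(x, (⟨y, hy⟩ : J)) := Quot.out_eq _
          rcases Sym2.eq_iff.mp h2 with ⟨h3, h4⟩ | ⟨h3, h4⟩
          · rw [h3, h4] at h1; exact h1
          · rw [h3, h4] at h1
            rw [M.2.1.2, N.2.1.2, h1]
      · exact congrFun (congrArg Prod.snd hMN) (x, ⟨y, hy⟩)
    refine Subtype.ext (funext fun a => ?_)
    obtain ⟨c, hc⟩ := M.2.2.span a
    obtain ⟨c', hc'⟩ := N.2.2.span a
    have hN : ∀ i : J, N.1 i = M.1 i := fun i => (funext (hJJ i)).symm
    simp only [hN] at hc'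
    have hzero : ∀ x : J, ∑ i : J, (c i - c' i) * M.1 i x = 0 := by
      intro x
      have h1 : M.1 a x = N.1 a x := by rw [M.2.1.2, N.2.1.2, hJJ]
      rw [hc, hc'] at h1
      simp only [Finset.sum_apply, Pi.smul_apply, smul_eq_mul] at h1
      simp only [sub_mul, Finset.sum_sub_distrib, h1, sub_self]
    -- By antisymmetry the columns indexed by `J` span all columns, so agreement of row `a` on `J`
    -- propagates.
    have hall : ∀ y, ∑ i : J, (c i - c' i) * M.1 i y = 0 := by
      intro y
      obtain ⟨b, hb⟩ := M.2.2.span y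
      have h2 : ∀ i : J, M.1 i y = ∑ x : J, b x * M.1 i x := by
        intro i
        rw [M.2.1.2, hb]
        simp only [Finset.sum_apply, Pi.smul_apply, smul_eq_mul]
        rw [← Finset.sum_neg_distrib]
        exact Finset.sum_congr rfl fun x _ => by rw [M.2.1.2 i x]; ring
      simp only [h2, Finset.mul_sum]
      rw [Finset.sum_comm]
      refine Finset.sum_eq_zero fun x _ => ?_
      refine Eq.trans ?_ ((congrArg (b x * ·) (hzero x)).trans (mul_zero _))
      simp only [Finset.mul_sum]
      exact Finset.sum_congr rfl fun i _ => by ring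
    rw [hc, hc']
    funext y
    have := hall y
    simp only [sub_mul, Finset.sum_sub_distrib] at this
    simpa using sub_eq_zero.mp this
  refine (Nat.card_le_card_of_injective f hf).trans_eq ?_
  have hcard : Nat.card {a // a ∉ J} = Fintype.card r - J.card := by
    rw [Nat.card_eq_fintype_card, Fintype.card_subtype_compl]; simp
  rw [Nat.card_prod, Nat.card_fun, Nat.card_fun, Nat.card_prod, hcard,
    Nat.card_eq_fintype_card (α := {e : Sym2 J // ¬ e.IsDiag}), Sym2.card_subtype_not_diag,
    ← pow_add]
  simp

/-- Generic matrices over a large finite field separate alternating matrices, when the exponents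
in the count of degenerate pairs are small. -/
theorem exists_separatesAlternating_of_card {r : ℕ} {p s κ : Type*} [Fintype p] [Fintype s]
    [Fintype κ]
    (hexp : ∀ t, 1 ≤ t → t ≤ r → ∀ k ≤ Fintype.card κ * t, k ≤ Fintype.card s →
      k * Fintype.card s + (Fintype.card κ * t - k) * k + Fintype.card p * (Fintype.card κ * t - k)
        + (t.choose 2 + t * (r - t)) ≤ Fintype.card κ * t * (Fintype.card p + Fintype.card s))
    (hF : 2 ^ r * 2 ^ (Fintype.card κ * r) + 1 < Nat.card F) :
    ∃ (A : κ → Matrix p (Fin r) F) (B : κ → Matrix (Fin r) s F), SeparatesAlternating A B := by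
  classical
  by_contra! hcon
  have hbad : ∀ θ : (κ → Matrix p (Fin r) F) × (κ → Matrix (Fin r) s F),
      ∃ M : Matrix (Fin r) (Fin r) F, ((∀ x, M x x = 0) ∧ (∀ x y, M x y = - M y x)) ∧
        ∑ k, θ.1 k * M * θ.2 k = 0 ∧ M ≠ 0 := by
    intro θ
    have := hcon θ.1 θ.2
    unfold SeparatesAlternating at this
    push Not at this
    obtain ⟨M, h1, h2, h3, h4⟩ := this
    exact ⟨M, ⟨h1, h2⟩, h3, h4⟩
  choose m hm using hbad
  choose J hJ using fun M : Matrix (Fin r) (Fin r) F => exists_isRowBasis M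
  let Θ := (κ → Matrix p (Fin r) F) × (κ → Matrix (Fin r) s F)
  let 𝓜 : Finset (Fin r) → Type _ := fun J => {M : Matrix (Fin r) (Fin r) F //
    ((∀ x, M x x = 0) ∧ (∀ x y, M x y = - M y x)) ∧ IsRowBasis M J}
  let 𝓑 : (J : Finset (Fin r)) → 𝓜 J → Type _ := fun _ M =>
    {θ : Θ // M.1 ≠ 0 ∧ ∑ k, θ.1 k * M.1 * θ.2 k = 0}
  let tot := Fintype.card κ * r * (Fintype.card p + Fintype.card s)
  have hΘ : Nat.card Θ = Nat.card F ^ tot := by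
    rw [Nat.card_prod, Nat.card_fun, Nat.card_fun, card_matrix, card_matrix, ← pow_mul, ← pow_mul,
      ← pow_add]
    simp only [Fintype.card_fin, Nat.card_eq_fintype_card (α := κ), tot]
    ring
  -- Every nonzero multiple of a bad `M` is bad too. The resulting factor `|F| - 1` exceeds the
  -- constant from the choices of row bases, so a non-strict exponent inequality is enough.
  let g : Θ × Fˣ → Σ J : Finset (Fin r), Σ M : 𝓜 J, 𝓑 J M := fun x =>
    ⟨J ((x.2 : F) • m x.1), ⟨(x.2 : F) • m x.1, ⟨fun i => by simp [(hm x.1).1.1],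
      fun i j => by simp [(hm x.1).1.2 i j]⟩, hJ _⟩, x.1,
      smul_ne_zero x.2.ne_zero (hm x.1).2.2, by
        simp [← Finset.smul_sum, (hm x.1).2.1]⟩
  have hg : Function.Injective g := by
    intro x y hxy
    have h : ∀ a b : Σ J : Finset (Fin r), Σ M : 𝓜 J, 𝓑 J M, a = b →
        a.2.1.1 = b.2.1.1 ∧ a.2.2.1 = b.2.2.1 := by rintro a _ rfl; exact ⟨rfl, rfl⟩
    obtain ⟨h1, h2⟩ := h _ _ hxy
    have h3 : x.1 = y.1 := h2
    have h4 : (x.2 : F) • m x.1 = (y.2 : F) • m y.1 := h1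
    rw [← h3, ← sub_eq_zero, ← sub_smul, smul_eq_zero, or_iff_left (hm x.1).2.2, sub_eq_zero] at h4
    exact Prod.ext h3 (Units.ext h4)
  have hcount := Nat.card_le_card_of_injective g hg
  have hQ : 0 < Nat.card F := Nat.card_pos
  rw [Nat.card_prod, Nat.card_units, hΘ, Nat.card_sigma] at hcount
  have hJle : ∀ J : Finset (Fin r), Nat.card (Σ M : 𝓜 J, 𝓑 J M) ≤
      2 ^ (Fintype.card κ * r) * Nat.card F ^ tot := by
    intro J
    rcases J.eq_empty_or_nonempty with rfl | hne
    · have : IsEmpty (Σ M : 𝓜 ∅, 𝓑 ∅ M) := ⟨fun x => x.2.2.1 (by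
        ext a b
        obtain ⟨c, hc⟩ := x.1.2.2.span a
        rw [hc]; simp)⟩
      simp
    have htr : J.card ≤ r := by simpa using Finset.card_le_univ J
    set d := J.card.choose 2 + J.card * (r - J.card) with hd
    have hB : ∀ M : 𝓜 J, Nat.card (𝓑 J M) * Nat.card F ^ d ≤
        2 ^ (Fintype.card κ * r) * Nat.card F ^ tot := by
      intro M
      have h1 := card_annihilating_mul (p := p) (s := s) (κ := κ) M.2.2
      have h2 := card_pairs_mul_le (F := F) (p := p) (n := κ × J) (s := s) d (fun k hk hks => by
        simp only [Fintype.card_prod, Fintype.card_coe] at hk ⊢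
        exact hexp _ hne.card_pos htr k hk hks)
      simp only [Fintype.card_prod, Fintype.card_coe] at h2
      have h3 : Nat.card (𝓑 J M) ≤ Nat.card {θ : Θ // ∑ k, θ.1 k * M.1 * θ.2 k = 0} :=
        Nat.card_le_card_of_injective (fun θ => ⟨θ.1, θ.2.2⟩) fun a b h => by
          have h' := congrArg Subtype.val h
          exact Subtype.ext h'
      rw [Fintype.card_fin] at h1
      refine (Nat.mul_le_mul_right _ h3).trans ?_
      refine Nat.le_of_mul_le_mul_right (c := Nat.card F ^ (Fintype.card κ * J.card *
        (Fintype.card p + Fintype.card s))) ?_ (pow_pos hQ _)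
      rw [mul_right_comm, h1, mul_assoc]
      refine (Nat.mul_le_mul_left _ h2).trans ?_
      rw [← mul_assoc, mul_comm (Nat.card F ^ _)]
      refine Nat.mul_le_mul_right _ (Nat.mul_le_mul_right _ ?_)
      exact Nat.pow_le_pow_right (by norm_num) (Nat.mul_le_mul_left _ htr)
    have hM : Nat.card (𝓜 J) ≤ Nat.card F ^ d := by
      simpa using card_alternating_isRowBasis_le (F := F) J
    have : Fintype (𝓜 J) := Fintype.ofFinite _
    refine Nat.le_of_mul_le_mul_right (c := Nat.card F ^ d) ?_ (pow_pos hQ _)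
    rw [Nat.card_sigma, Finset.sum_mul]
    refine (Finset.sum_le_sum fun M _ => hB M).trans ?_
    rw [Finset.sum_const, smul_eq_mul, Finset.card_univ, ← Nat.card_eq_fintype_card, mul_comm]
    exact Nat.mul_le_mul_left _ hM
  have hfin := hcount.trans (Finset.sum_le_sum fun J _ => hJle J)
  rw [Finset.sum_const, smul_eq_mul, Finset.card_univ, Fintype.card_finset, Fintype.card_fin,
    ← mul_assoc, mul_comm] at hfin
  have := Nat.le_of_mul_le_mul_right hfin (pow_pos hQ _)
  omega

end Counting

/-! ### Exponent inequality, exact values and asymptotics -/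

section MainTheorem

universe u

attribute [local instance 100] LieRing.ofAssociativeRing

theorem two_mul_choose_two (r : ℕ) : 2 * r.choose 2 = r * (r - 1) := by
  rw [Nat.choose_two_right, Nat.mul_div_cancel' (Nat.even_mul_pred_self r).two_dvd]

/-- In the application `t` is the rank of `M`, `r' = r - t`, `c = r.choose 2`, and `k` is the rank
of the second factor of size `2 * t` by `s`. -/
theorem exponent_aux {p s t r' k l c : ℤ} (hps : p ≤ s) (hsp : s ≤ p + 1) (hr : c ≤ p * s)
    (hN : 2 * c * 2 ≤ (p + s) ^ 2) (ht : 1 ≤ t) (hr0 : 0 ≤ r') (hks : k ≤ s)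
    (hkl : 2 * t = k + l) (h1 : 2 * c = (t + r') * (t + r' - 1)) :
    2 * (l * k) + t * (t - 1) + 2 * (t * r') ≤ 2 * (k * p + l * s) := by
  rcases le_or_gt (p + s) (2 * t) with hbig | hsmall
  -- This gives `l * k ≤ k * p + l * s - p * s`; the alternating matrices contribute at most `c ≤ p
  -- * s`.
  · have h3 : 0 ≤ (s - k) * (l - p) := mul_nonneg (by linarith) (by linarith)
    have h4 : 0 ≤ r' * (r' - 1) := by
      rcases hr0.eq_or_lt with h | h
      · simp [← h]
      · exact mul_nonneg hr0 (by linarith [Int.add_one_le_of_lt h])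
    linarith
  · obtain ⟨j, rfl⟩ : ∃ j, k = t + j := ⟨k - t, by ring⟩
    obtain ⟨ε, rfl⟩ : ∃ ε, s = p + ε := ⟨s - p, by ring⟩
    obtain rfl : l = t - j := by linarith
    -- An integer argument: `ε` is 0 or 1. It reduces the claim to the balanced case `k = l = t`.
    have h3 : 0 ≤ j * (j - ε) := by
      rcases le_or_gt j 0 with h | h
      · exact mul_nonneg_of_nonpos_of_nonpos h (by linarith)
      · exact mul_nonneg h.le (by linarith [Int.add_one_le_of_lt h])
    -- A linear form of `(p + s)² ≥ 2r(r-1)`, available because `4/3 < √2`.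
    have h4 : 4 * (t + r') ≤ 3 * (p + (p + ε)) + 3 := by
      by_contra! hlt
      have h5 : 3 * (p + (p + ε)) ≤ 4 * (t + r') - 4 := by linarith [Int.add_one_le_of_lt hlt]
      have h6 : 9 ≤ 3 * (p + (p + ε)) := by linarith [Int.add_one_le_of_lt hsmall]
      have h7 : (3 * (p + (p + ε))) ^ 2 ≤ (4 * (t + r') - 4) ^ 2 :=
        pow_le_pow_left₀ (by linarith) h5 2
      have h8 : 0 ≤ (t + r' - 2) * (t + r') := mul_nonneg (by linarith) (by linarith)
      nlinarith
    have h5 : 0 ≤ t * (2 * (p + (p + ε)) - 2 * t - 2 * r' - t + 1) :=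
      mul_nonneg (by linarith) (by linarith [Int.add_one_le_of_lt hsmall])
    linarith

/-- The exponent inequality behind the count of degenerate pairs. -/
theorem exponent_le {r p s : ℕ} (hps : p ≤ s) (hsp : s ≤ p + 1) (hr : r.choose 2 ≤ p * s)
    (hN : 2 * r.choose 2 * 2 ≤ (p + s) ^ 2) {t : ℕ} (ht : 1 ≤ t) (htr : t ≤ r) {k : ℕ}
    (hk : k ≤ 2 * t) (hks : k ≤ s) :
    k * s + (2 * t - k) * k + p * (2 * t - k) + (t.choose 2 + t * (r - t)) ≤
      2 * t * (p + s) := by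
  have h1 := two_mul_choose_two r
  have h2 := two_mul_choose_two t
  obtain ⟨r', rfl⟩ := Nat.exists_eq_add_of_le htr
  obtain ⟨l, hl⟩ := Nat.exists_eq_add_of_le hk
  have e1 : 2 * t - k = l := by omega
  have e2 : t + r' - t = r' := by omega
  rw [e1, e2]
  have h1' : 2 * ((t + r').choose 2 : ℤ) = (t + r') * (t + r' - 1) := by
    have : ((t + r' - 1 : ℕ) : ℤ) = t + r' - 1 := by omega
    rw [← this]; exact_mod_cast h1
  have h2' : 2 * (t.choose 2 : ℤ) = t * (t - 1) := by
    have : ((t - 1 : ℕ) : ℤ) = t - 1 := by omega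
    rw [← this]; exact_mod_cast h2
  have hkl : (2 * t : ℤ) = k + l := by exact_mod_cast hl
  zify at hps hsp hr hN ht hks ⊢
  have h := exponent_aux hps hsp hr hN ht (Int.natCast_nonneg r') hks hkl h1'
  rw [hkl]
  linarith

theorem exists_faithful_of_le {K : Type u} [Field K] [CharZero K] {r N : ℕ} (hr : 2 ≤ r)
    (hN : 2 * (r * (r - 1)) ≤ N ^ 2) :
    ∃ (V : Type u) (_ : AddCommGroup V) (_ : Module K V) (_ : FiniteDimensional K V)
      (π : FreeTwoStepNilpotent K r →ₗ⁅K⁆ Module.End K V),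
      Function.Injective π ∧ Module.finrank K V = N + 2 := by
  -- Balancing maximizes `p * s`, giving `⌊N² / 4⌋ ≥ r.choose 2`.
  obtain ⟨p, s, hps, hsp, rfl⟩ : ∃ p s, p ≤ s ∧ s ≤ p + 1 ∧ N = p + s :=
    ⟨N / 2, N - N / 2, by omega, by omega, by omega⟩
  have h2 := two_mul_choose_two r
  have hch : r.choose 2 ≤ p * s := by
    rcases Nat.eq_or_lt_of_le hps with rfl | hlt
    · nlinarith
    · obtain rfl : s = p + 1 := by omega
      have : 4 * r.choose 2 < 4 * (p * (p + 1)) + 4 := by nlinarith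
      omega
  obtain ⟨ℓ, hℓ, hprime⟩ := Nat.exists_infinite_primes (2 ^ r * 2 ^ (2 * r) + 2)
  have : Fact ℓ.Prime := ⟨hprime⟩
  obtain ⟨A, B, hAB⟩ := exists_separatesAlternating_of_zmod (ℓ := ℓ) (r := r) K
    (exists_separatesAlternating_of_card (p := Fin p) (s := Fin s) (κ := Fin 2)
      (fun t ht htr k hk hks => by
        simp only [Fintype.card_fin] at hk hks ⊢
        exact exponent_le hps hsp hch (by rw [h2]; linarith) ht htr hk hks)
      (by rw [Nat.card_zmod, Fintype.card_fin]; omega))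
  obtain ⟨V, i1, i2, i3, π, hπ, hV⟩ := hAB.exists_faithful hr
  exact ⟨V, i1, i2, i3, π, hπ, by omega⟩

theorem minFaithfulDim_eq {K : Type u} [Field K] {r n : ℕ}
    (hmem : ∃ (V : Type u) (_ : AddCommGroup V) (_ : Module K V) (_ : FiniteDimensional K V)
      (π : FreeTwoStepNilpotent K r →ₗ⁅K⁆ Module.End K V),
      Function.Injective π ∧ Module.finrank K V = n)
    (hle : ∀ (V : Type u) [AddCommGroup V] [Module K V] [FiniteDimensional K V]
      (π : FreeTwoStepNilpotent K r →ₗ⁅K⁆ Module.End K V), Function.Injective π →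
      n ≤ Module.finrank K V) :
    minFaithfulDim K (FreeTwoStepNilpotent K r) = n := by
  refine le_antisymm (Nat.sInf_le hmem) (le_csInf ⟨n, hmem⟩ ?_)
  rintro _ ⟨V, _, _, _, π, hπ, rfl⟩
  exact hle V π hπ

theorem sqrt_le_natCast_iff (r N : ℕ) (hr : 1 ≤ r) :
    Real.sqrt (2 * (r : ℝ) * ((r : ℝ) - 1)) ≤ N ↔ 2 * (r * (r - 1)) ≤ N ^ 2 := by
  have h : (((r - 1 : ℕ) : ℝ)) = r - 1 := by rw [Nat.cast_sub hr, Nat.cast_one]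
  rw [Real.sqrt_le_left (Nat.cast_nonneg N), mul_assoc, ← h]
  norm_cast

theorem minFaithfulDim_of_four_le (K : Type u) [Field K] [CharZero K] {r : ℕ} (hr : 4 ≤ r) :
    minFaithfulDim K (FreeTwoStepNilpotent K r) =
      ⌈Real.sqrt (2 * (r : ℝ) * ((r : ℝ) - 1))⌉₊ + 2 := by
  refine minFaithfulDim_eq
    (exists_faithful_of_le (by omega) ((sqrt_le_natCast_iff r _ (by omega)).mp (Nat.le_ceil _))) ?_
  intro V _ _ _ π hπ
  rcases faithful_estimate (by omega) π hπ with ⟨a, b, hab, hm⟩ | h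
  · have h1 : ⌈Real.sqrt (2 * (r : ℝ) * ((r : ℝ) - 1))⌉₊ ≤ a + b := by
      rw [Nat.ceil_le, sqrt_le_natCast_iff r _ (by omega), ← two_mul_choose_two]
      zify at hm ⊢
      nlinarith [sq_nonneg ((a : ℤ) - b)]
    omega
  · obtain ⟨q, rfl⟩ := Nat.exists_eq_add_of_le hr
    -- The bound is `2 * r - 3`: from `r = 4` on, the alternative `2 * r - 1` is no weaker than the
    -- square root bound.
    have h1 : ⌈Real.sqrt (2 * ((4 + q : ℕ) : ℝ) * (((4 + q : ℕ) : ℝ) - 1))⌉₊ ≤ 2 * q + 5 := by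
      rw [Nat.ceil_le, sqrt_le_natCast_iff _ _ (by omega), show 4 + q - 1 = 3 + q by omega]
      nlinarith
    omega

theorem minFaithfulDim_of_le_three (K : Type u) [Field K] [CharZero K] {r : ℕ} (hr : 2 ≤ r)
    (hr' : r ≤ 3) : minFaithfulDim K (FreeTwoStepNilpotent K r) = 2 * r - 1 := by
  refine minFaithfulDim_eq ?_ ?_
  · obtain ⟨n, rfl⟩ : ∃ n, r = n + 1 := ⟨r - 1, by omega⟩
    obtain ⟨V, i1, i2, i3, π, hπ, hV⟩ :=
      (separatesAlternating_consecutive K n).exists_faithful hr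
    exact ⟨V, i1, i2, i3, π, hπ, by omega⟩
  · intro V _ _ _ π hπ
    rcases faithful_estimate hr π hπ with ⟨a, b, hab, hm⟩ | h
    · have h1 : 4 * r.choose 2 ≤ (a + b) ^ 2 := by
        zify at hm ⊢
        nlinarith [sq_nonneg ((a : ℤ) - b)]
      have h2 := two_mul_choose_two r
      -- For `r = 2, 3` the product bound forces dimension at least 4 and 6, above `2 * r - 1`.
      interval_cases r
      · have : 1 < a + b := by by_contra! h; interval_cases h3 : a + b <;> omega
        omega
      · have : 3 < a + b := by by_contra! h; interval_cases h3 : a + b <;> omega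
        omega
    · omega

theorem ceil_sqrt_four_five {r : ℕ} (hr : 4 ≤ r) (hr' : r ≤ 5) :
    ⌈Real.sqrt (2 * (r : ℝ) * ((r : ℝ) - 1))⌉₊ + 2 = 2 * r - 1 := by
  have h : ⌈Real.sqrt (2 * (r : ℝ) * ((r : ℝ) - 1))⌉₊ = 2 * r - 3 := by
    refine le_antisymm ?_ ?_
    · rw [Nat.ceil_le, sqrt_le_natCast_iff r _ (by omega)]
      interval_cases r <;> norm_num
    · by_contra! hlt
      have h1 : ⌈Real.sqrt (2 * (r : ℝ) * ((r : ℝ) - 1))⌉₊ ≤ 2 * r - 4 := by omega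
      rw [Nat.ceil_le, sqrt_le_natCast_iff r _ (by omega)] at h1
      interval_cases r <;> norm_num at h1
  omega

theorem isEquivalent_of_abs_sub_le {f g : ℕ → ℝ} (C : ℝ) (h : ∀ᶠ r in atTop, |f r - g r| ≤ C)
    (hg : Tendsto g atTop atTop) : f ~[atTop] g := by
  have h1 : (f - g) =O[atTop] fun _ => (1 : ℝ) :=
    IsBigO.of_bound C (h.mono fun r hr => by simpa using hr)
  exact h1.trans_isLittleO (isLittleO_const_left.mpr (Or.inr (tendsto_norm_atTop_atTop.comp hg)))

theorem tendsto_sqrt_two_mul : Tendsto (fun r : ℕ => Real.sqrt 2 * (r : ℝ)) atTop atTop :=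
  tendsto_natCast_atTop_atTop.const_mul_atTop (by positivity)

theorem minFaithfulDim_isEquivalent (K : Type u) [Field K] [CharZero K] :
    (fun r : ℕ => (minFaithfulDim K (FreeTwoStepNilpotent K r) : ℝ)) ~[atTop]
      (fun r : ℕ => Real.sqrt 2 * (r : ℝ)) := by
  -- The 3 absorbs the summand 2 and the rounding error of the ceiling.
  refine isEquivalent_of_abs_sub_le 3 ?_ tendsto_sqrt_two_mul
  filter_upwards [eventually_ge_atTop 4] with r hr
  rw [minFaithfulDim_of_four_le K hr]
  have hr1 : (4 : ℝ) ≤ r := by exact_mod_cast hr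
  have h2 : Real.sqrt 2 ^ 2 = 2 := Real.sq_sqrt (by norm_num)
  have h2n : 0 ≤ Real.sqrt 2 := Real.sqrt_nonneg 2
  have h2le : Real.sqrt 2 ≤ 2 := by nlinarith
  have hlow : Real.sqrt 2 * (r - 1) ≤ Real.sqrt (2 * (r : ℝ) * ((r : ℝ) - 1)) := by
    refine Real.le_sqrt_of_sq_le ?_
    rw [mul_pow, h2]
    nlinarith
  have hup : Real.sqrt (2 * (r : ℝ) * ((r : ℝ) - 1)) ≤ Real.sqrt 2 * r := by
    refine Real.sqrt_le_iff.mpr ⟨by positivity, ?_⟩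
    rw [mul_pow, h2]
    nlinarith
  have hc1 := Nat.le_ceil (Real.sqrt (2 * (r : ℝ) * ((r : ℝ) - 1)))
  have hc2 := Nat.ceil_lt_add_one (Real.sqrt_nonneg (2 * (r : ℝ) * ((r : ℝ) - 1)))
  rw [abs_le]
  push_cast
  constructor <;> linarith

theorem two_sqrt_finrank_isEquivalent (K : Type u) [Field K] :
    (fun r : ℕ => 2 * Real.sqrt (Module.finrank K (FreeTwoStepNilpotent K r) : ℝ)) ~[atTop]
      (fun r : ℕ => Real.sqrt 2 * (r : ℝ)) := by
  refine isEquivalent_of_abs_sub_le 3 (Eventually.of_forall fun r => ?_) tendsto_sqrt_two_mul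
  have h2 : Real.sqrt 2 ^ 2 = 2 := Real.sq_sqrt (by norm_num)
  have h2n : 0 ≤ Real.sqrt 2 := Real.sqrt_nonneg 2
  have h2le : Real.sqrt 2 ≤ 2 := by nlinarith
  have hr0 : (0 : ℝ) ≤ r := Nat.cast_nonneg r
  have hdim : ((Module.finrank K (FreeTwoStepNilpotent K r) : ℕ) : ℝ) = r * (r + 1) / 2 := by
    rw [finrank_freeTwoStepNilpotent, Nat.cast_add, Nat.cast_choose_two]
    ring
  rw [hdim]
  have hlow : Real.sqrt 2 / 2 * r ≤ Real.sqrt ((r : ℝ) * (r + 1) / 2) := by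
    refine Real.le_sqrt_of_sq_le ?_
    rw [mul_pow, div_pow, h2]
    nlinarith
  have hup : Real.sqrt ((r : ℝ) * (r + 1) / 2) ≤ Real.sqrt 2 / 2 * (r + 1) := by
    refine Real.sqrt_le_iff.mpr ⟨by positivity, ?_⟩
    rw [mul_pow, div_pow, h2]
    nlinarith
  rw [abs_le]
  constructor <;> linarith

end MainTheorem

theorem mainTheorem1 (K : Type*) [Field K] [CharZero K] :
    (∀ r : ℕ, 4 ≤ r →
      minFaithfulDim K (FreeTwoStepNilpotent K r) =
        ⌈Real.sqrt (2 * (r : ℝ) * ((r : ℝ) - 1))⌉₊ + 2) ∧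
    (∀ r : ℕ, 2 ≤ r → r ≤ 5 →
      minFaithfulDim K (FreeTwoStepNilpotent K r) = 2 * r - 1) ∧
    (fun r : ℕ => (minFaithfulDim K (FreeTwoStepNilpotent K r) : ℝ)) ~[atTop]
      (fun r : ℕ => Real.sqrt 2 * (r : ℝ)) ∧
    (fun r : ℕ => (minFaithfulDim K (FreeTwoStepNilpotent K r) : ℝ)) ~[atTop]
      (fun r : ℕ => 2 * Real.sqrt (Module.finrank K (FreeTwoStepNilpotent K r) : ℝ)) := by
  refine ⟨fun r hr => minFaithfulDim_of_four_le K hr, fun r hr hr' => ?_,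
    minFaithfulDim_isEquivalent K,
    (minFaithfulDim_isEquivalent K).trans (two_sqrt_finrank_isEquivalent K).symm⟩
  rcases Nat.lt_or_ge r 4 with h | h
  · exact minFaithfulDim_of_le_three K hr (by omega)
  · rw [minFaithfulDim_of_four_le K h, ceil_sqrt_four_five h hr']
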